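/- Let $\mathscr{A}$ be a $W^\star$-algebra, that is, a $C^\star$-algebra which is the dual of a Banach space (its predual), and let $\mathscr{A}_{sa}$ be the real Banach space of its self-adjoint elements, with Jordan product $\{a,b\}=\tfrac12(ab+ba)$. Let $\omega$ be a normal positive linear functional on $\mathscr{A}$, i.e. a bounded linear functional which comes from an element of the predual and satisfies $\omega(b^\dagger b)\ge 0$ for all $b\in\mathscr{A}$. For $a\in\mathscr{A}_{sa}$ let $\eta_a\in(\mathscr{A}_{sa})^*$ be given by $\eta_a(b)=\omega(\{a,b\})$, and put $J_\omega=\{\eta_a : a\in\mathscr{A}_{sa}\}$. The formula $G_\omega(\eta_a,\eta_b)=\omega(\{a,b\})$ defines an inner product on $J_\omega$. The real Hilbert space $\mathcal{J}_\omega$, called the J-Hilbert space of $\omega$, is the completion of $J_\omega$ with respect to $G_\omega$; its inner product is again denoted by $G_\omega$. Let $AC_\omega\subseteq(\mathscr{A}_{sa})^*$, with the dual norm, be the space of bounded real linear functionals $\eta$ on $\mathscr{A}_{sa}$ which are absolutely continuous with respect to $\omega$: for every $\epsilon>0$ there is $\delta>0$ such that $|\eta(a)|<\epsilon$ for every positive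 $a$ with $\|a\|\le 1$ and $\omega(a)<\delta$. Then the following hold. 1. $\mathcal{J}_\omega\subseteq AC_\omega$ as sets: the inclusion $J_\omega\subseteq AC_\omega$ holds and extends to an injective bounded linear map $\mathrm{i}\colon\mathcal{J}_\omega\to AC_\omega$, given by $\mathrm{i}(\eta)(a)=G_\omega(\eta,\eta_a)$ for $\eta\in\mathcal{J}_\omega$ and $a\in\mathscr{A}_{sa}$. 2. The dual map $\mathrm{i}^*\colon(AC_\omega)^*\to(\mathcal{J}_\omega)^*$, $F\mapsto F\circ\mathrm{i}$, is injective and has dense range, so that $(AC_\omega)^*$ is identified with a dense subspace of the dual of $\mathcal{J}_\omega$. 3. There is a unique projection $p\in\mathscr{A}$ (the support projection of $\omega$) such that $\omega(a)=\omega(ap)=\omega(pa)=\omega(pap)$ for all $a\in\mathscr{A}$ and such that $\omega$ is faithful on $p\mathscr{A}p$. With $q=\mathbb{I}-p$ and $\mathscr{A}^\omega_{sa}=(p\mathscr{A}p\oplus p\mathscr{A}q\oplus q\mathscr{A}p)_{sa}$, the map that sends $a\in\mathscr{A}^\omega_{sa}$ to the functional $\eta\mapsto\eta(a)$ on $AC_\omega$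 is an isomorphism of real topological vector spaces $\mathscr{A}^\omega_{sa}\cong(AC_\omega)^*$. -/

import Mathlib

set_option maxSynthPendingDepth 3

open scoped ComplexOrder

universe u

/-! ### Normal positive linear functionals on a W⋆-algebra -/

/-- A bounded linear functional on `A` is normal if it comes, through the canonical immersion of a
predual of `A` in the dual of `A`, from an element `x` of the predual. The identification `e` of
`A` with the dual of the Banach space `X` is conjugate linear, as in `WStarAlgebra`, hence the
conjugation in the formula `ω a = conj (e⁻¹(a)(x))`. -/
def IsNormalFunctional {A : Type u} [CStarAlgebra A] (ω : StrongDual ℂ A) : Prop :=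
  ∃ (X : Type u) (_ : NormedAddCommGroup X) (_ : NormedSpace ℂ X) (_ : CompleteSpace X)
    (e : StrongDual ℂ X ≃ₗᵢ⋆[ℂ] A) (x : X),
    ∀ a : A, ω a = star (e.symm a x)

/-- Normal positive linear functionals. Positive elements of `A` are those of the form `b⋆ b`. -/
structure NormalPositiveFunctional (A : Type*) [CStarAlgebra A] where
  /-- the underlying bounded linear functional -/
  toDual : StrongDual ℂ A
  nonneg : ∀ b : A, 0 ≤ toDual (star b * b)
  normal : IsNormalFunctional toDual

section Jordan

variable {A : Type*} [CStarAlgebra A]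

/-- The Jordan product `{a, b} = (a b + b a) / 2` of self-adjoint elements. -/
noncomputable def jordanProd (a b : selfAdjoint A) : selfAdjoint A :=
  ⟨(1 / 2 : ℝ) • ((a : A) * b + (b : A) * a), by
    have ha : star (a : A) = a := a.2
    have hb : star (b : A) = b := b.2
    rw [selfAdjoint.mem_iff, star_smul, star_add, star_mul, star_mul, ha, hb, add_comm]
    simp⟩

namespace NormalPositiveFunctional

variable (ω : NormalPositiveFunctional A)

/-- The functional `η_a : b ↦ ω({a, b})` on the self-adjoint part of `A`; `ω` is real-valued
there, so that taking the real part only changes the type of the value. -/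
noncomputable def eta : selfAdjoint A →ₗ[ℝ] StrongDual ℝ (selfAdjoint A) where
  toFun a :=
    { toFun := fun b => (ω.toDual (jordanProd a b : A)).re
      map_add' := fun b c => by
        simp only [jordanProd, AddSubgroup.coe_add, mul_add, add_mul, smul_add, map_add,
          Complex.add_re]
        ring
      map_smul' := fun r b => by
        have h : (jordanProd a (r • b) : A) = (r : ℂ) • (jordanProd a b : A) := by
          simp only [jordanProd, selfAdjoint.val_smul, mul_smul_comm, smul_mul_assoc,
            ← smul_add, Complex.coe_smul]
          rw [smul_comm]
        rw [h, map_smul]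
        simp
      cont := by
        unfold jordanProd
        fun_prop }
  map_add' a b := by
    ext c
    simp only [jordanProd, AddSubgroup.coe_add, mul_add, add_mul, smul_add, map_add,
      Complex.add_re, ContinuousLinearMap.coe_mk', LinearMap.coe_mk, AddHom.coe_mk,
      add_apply]
    ring
  map_smul' r a := by
    ext c
    have h : (jordanProd (r • a) c : A) = (r : ℂ) • (jordanProd a c : A) := by
      simp only [jordanProd, selfAdjoint.val_smul, mul_smul_comm, smul_mul_assoc,
        ← smul_add, Complex.coe_smul]
      rw [smul_comm]
    simp only [ContinuousLinearMap.coe_mk', LinearMap.coe_mk, AddHom.coe_mk, h, map_smul]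
    simp

theorem eta_apply (a b : selfAdjoint A) :
    ω.eta a b = (ω.toDual (jordanProd a b : A)).re := rfl

theorem eta_comm (a b : selfAdjoint A) : ω.eta a b = ω.eta b a := by
  simp only [eta_apply, jordanProd, add_comm]

theorem eta_self_nonneg (a : selfAdjoint A) : 0 ≤ ω.eta a a := by
  have ha : star (a : A) = a := a.2
  have h := ω.nonneg a
  rw [ha] at h
  have h2 : (jordanProd a a : A) = (a : A) * a := by
    simp only [jordanProd, ← two_smul ℝ ((a : A) * a), smul_smul]
    norm_num
  rw [eta_apply, h2]
  exact (Complex.le_def.1 h).1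

theorem eta_eq_zero {a : selfAdjoint A} (h : ω.eta a a = 0) : ω.eta a = 0 := by
  ext b
  let B : LinearMap.BilinForm ℝ (selfAdjoint A) :=
    ContinuousLinearMap.coeLM ℝ ∘ₗ ω.eta
  have key := LinearMap.BilinForm.apply_mul_apply_le_of_forall_zero_le B
    (fun x => ω.eta_self_nonneg x) a b
  change ω.eta a b * ω.eta b a ≤ ω.eta a a * ω.eta b b at key
  rw [h, zero_mul, ω.eta_comm b a] at key
  simpa using mul_self_eq_zero.1 (le_antisymm key (mul_self_nonneg _))

/-- `J_ω = {η_a : a self-adjoint}`. -/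
noncomputable def J : Submodule ℝ (StrongDual ℝ (selfAdjoint A)) :=
  LinearMap.range ω.eta

/-- The vector space `J_ω` without the norm inherited from the dual of the self-adjoint part of
`A`; it carries the inner product `G_ω` instead. -/
def PreJ : Type _ := ↥ω.J

noncomputable instance : AddCommGroup ω.PreJ := inferInstanceAs (AddCommGroup ↥ω.J)

noncomputable instance : Module ℝ ω.PreJ := inferInstanceAs (Module ℝ ↥ω.J)

/-- The identity map of `J_ω`, from `PreJ` to `J`. -/
noncomputable def ofPreJ : ω.PreJ ≃ₗ[ℝ] ↥ω.J := LinearEquiv.refl ℝ _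

/-- `η_a` as an element of the inner product space `J_ω`. -/
noncomputable def etaPreJ : selfAdjoint A →ₗ[ℝ] ω.PreJ :=
  ω.ofPreJ.symm.toLinearMap ∘ₗ ω.eta.rangeRestrict

/-- A self-adjoint `a` with `ξ = η_a`. -/
noncomputable def rep (ξ : ω.PreJ) : selfAdjoint A := Classical.choose (ω.ofPreJ ξ).2

theorem eta_rep (ξ : ω.PreJ) : ω.eta (ω.rep ξ) = (ω.ofPreJ ξ : StrongDual ℝ (selfAdjoint A)) :=
  Classical.choose_spec (ω.ofPreJ ξ).2

/-- The inner product `G_ω(η_a, η_b) = ω({a, b})` on `J_ω`; it does not depend on the choice of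
`a` and `b`, see `inner_etaPreJ`. -/
noncomputable abbrev preJCore : InnerProductSpace.Core ℝ ω.PreJ where
  inner ξ ζ := (ω.toDual (jordanProd (ω.rep ξ) (ω.rep ζ) : A)).re
  conj_inner_symm ξ ζ := by
    simp only [← eta_apply]
    exact ω.eta_comm _ _
  re_inner_nonneg ξ := ω.eta_self_nonneg _
  add_left ξ ζ χ := by
    simp only [← eta_apply, eta_rep, map_add, Submodule.coe_add, add_apply]
  smul_left ξ ζ r := by
    simp only [← eta_apply, eta_rep, map_smul, Submodule.coe_smul, smul_apply]
    rfl
  definite ξ h := by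
    simp only [← eta_apply] at h
    have h2 := ω.eta_eq_zero h
    rw [eta_rep] at h2
    exact ω.ofPreJ.map_eq_zero_iff.1 (Subtype.ext h2)

noncomputable instance : NormedAddCommGroup ω.PreJ :=
  InnerProductSpace.Core.toNormedAddCommGroup (cd := ω.preJCore)

noncomputable instance : InnerProductSpace ℝ ω.PreJ :=
  InnerProductSpace.ofCore ω.preJCore.toCore

theorem inner_etaPreJ (a b : selfAdjoint A) :
    inner ℝ (ω.etaPreJ a) (ω.etaPreJ b) = (ω.toDual (jordanProd a b : A)).re := by
  change ω.eta (ω.rep (ω.etaPreJ a)) (ω.rep (ω.etaPreJ b)) = ω.eta a b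
  have h (c : selfAdjoint A) : ω.eta (ω.rep (ω.etaPreJ c)) = ω.eta c := ω.eta_rep _
  rw [h, eta_comm, h, eta_comm]

/-- The J-Hilbert space of `ω`: the completion of `J_ω` for the inner product `G_ω`. It is a real
Hilbert space. -/
abbrev JHilbert : Type _ := UniformSpace.Completion ω.PreJ

/-- `AC_ω`: the bounded real linear functionals on the self-adjoint part of `A` which are
absolutely continuous with respect to `ω`. -/
def AC : Submodule ℝ (StrongDual ℝ (selfAdjoint A)) where
  carrier := {η | ∀ ε > (0 : ℝ), ∃ δ > (0 : ℝ), ∀ b : A, ‖star b * b‖ ≤ 1 →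
    (ω.toDual (star b * b)).re < δ → |η ⟨star b * b, IsSelfAdjoint.star_mul_self b⟩| < ε}
  zero_mem' := fun ε hε => ⟨1, one_pos, fun b _ _ => by simpa using hε⟩
  add_mem' := by
    intro η ζ hη hζ ε hε
    obtain ⟨δ₁, h₁, H₁⟩ := hη (ε / 2) (half_pos hε)
    obtain ⟨δ₂, h₂, H₂⟩ := hζ (ε / 2) (half_pos hε)
    refine ⟨min δ₁ δ₂, lt_min h₁ h₂, fun b hb hlt => ?_⟩
    have k₁ := H₁ b hb (hlt.trans_le (min_le_left _ _))
    have k₂ := H₂ b hb (hlt.trans_le (min_le_right _ _))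
    rw [add_apply]
    exact (abs_add_le _ _).trans_lt (by linarith)
  smul_mem' := by
    intro r η hη ε hε
    have hr : 0 < |r| + 1 := by positivity
    obtain ⟨δ, h, H⟩ := hη (ε / (|r| + 1)) (div_pos hε hr)
    refine ⟨δ, h, fun b hb hlt => ?_⟩
    have k := H b hb hlt
    rw [lt_div_iff₀ hr] at k
    rw [smul_apply, smul_eq_mul, abs_mul]
    nlinarith [abs_nonneg (η ⟨star b * b, IsSelfAdjoint.star_mul_self b⟩)]

/-- `p` is the support projection of `ω`: `ω(a) = ω(a p) = ω(p a) = ω(p a p)` for all `a`, and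
`ω` is faithful on `p A p`. -/
def IsSupportProjection (p : A) : Prop :=
  IsStarProjection p ∧
    (∀ a : A, ω.toDual a = ω.toDual (a * p) ∧ ω.toDual a = ω.toDual (p * a) ∧
      ω.toDual a = ω.toDual (p * a * p)) ∧
    ∀ a : A, ω.toDual (star (p * a * p) * (p * a * p)) = 0 → p * a * p = 0

end NormalPositiveFunctional

/-- The real vector space `(p A p ⊕ p A q ⊕ q A p)_sa` with `q = 1 - p`, for `p` in `A`. -/
def cornerSA (p : A) : Submodule ℝ (selfAdjoint A) where
  carrier := {a | ∃ x y z : A,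
    (a : A) = p * x * p + p * y * (1 - p) + (1 - p) * z * p}
  zero_mem' := ⟨0, 0, 0, by simp⟩
  add_mem' := by
    rintro a b ⟨x, y, z, h⟩ ⟨x', y', z', h'⟩
    refine ⟨x + x', y + y', z + z', ?_⟩
    rw [AddSubgroup.coe_add, h, h']
    noncomm_ring
  smul_mem' := by
    rintro r a ⟨x, y, z, h⟩
    refine ⟨r • x, r • y, r • z, ?_⟩
    rw [selfAdjoint.val_smul, h]
    simp only [smul_add, mul_smul_comm, smul_mul_assoc]

end Jordan

/-! The argument is governed by the seminorm `a ↦ ω(a²)^(1/2)`, which is the norm of `η_a` in the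
J-Hilbert space. If `0 ≤ a ≤ 1` then `a² ≤ a`, so `a ↦ G_ω(η, η_a)` is absolutely continuous for
every `η` in the J-Hilbert space; it is nonzero for `η ≠ 0` because the `η_a` are dense. Conversely,
splitting into positive and negative parts and Cauchy–Schwarz show that an absolutely continuous
functional is small, on bounded sets, where this seminorm is small (`exists_abs_lt_of_mem_AC`).
Hahn–Banach separation in the J-Hilbert space turns this into weak continuity on bounded families
(`tendsto_of_mem_AC`).

A bounded `F` on `AC_ω` is approximated on finite sets by evaluations at points of norm at most
`‖F‖` (Helly's lemma). Weak compactness of balls then produces one `a` with `F η = η a` for all `η`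
(`exists_eq_apply`). If `F ∘ i = 0`, evaluation at `η_a` gives `ω(a²) = 0`, and then every
absolutely continuous functional kills `a`; the range of `F ↦ F ∘ i` is dense because it contains
all pairings with `η_a`. The self-adjoint `a` with `ω(a²) = 0` are those of the form `q a q`, so
each evaluation has exactly one representative in the corner.

The operator-algebraic input is weak continuity of multiplication on bounded families
(`weakLim_mul_left`) and the support projection (`exists_isSupportProjection`). Both are derived
from the predual by Sakai's method: balls are weakly closed, so self-adjointness, positivity and
one-sided ranges of projections, expressed through norm estimates, pass to weak limits. -/

/-! ### Weak convergence with respect to a predual -/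

section Predual

open Filter Topology

variable {A : Type u} [CStarAlgebra A]

/-- The family `x` converges to `a` along `l`, tested against the functionals in `M`. -/
def WeakLim (M : Set (StrongDual ℂ A)) {ι : Type*} (l : Filter ι) (x : ι → A) (a : A) : Prop :=
  ∀ f ∈ M, Tendsto (fun i => f (x i)) l (𝓝 (f a))

/-- The functionals in `M` separate the points of `A`, and closed balls of `A` are compact for the
topology that they induce. -/
structure IsPredual (M : Set (StrongDual ℂ A)) : Prop where
  exists_lim : ∀ (U : Ultrafilter A) (r : ℝ), (∀ᶠ a in (U : Filter A), ‖a‖ ≤ r) →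
    ∃ a, ‖a‖ ≤ r ∧ WeakLim M (U : Filter A) id a
  eq_zero : ∀ a, (∀ f ∈ M, f a = 0) → a = 0

/-- The functionals on `A` that come from a predual `X`. -/
def predualSet {X : Type*} [NormedAddCommGroup X] [NormedSpace ℂ X]
    (e : StrongDual ℂ X ≃ₗᵢ⋆[ℂ] A) : Set (StrongDual ℂ A) :=
  {f | ∃ x : X, ∀ a, f a = star (e.symm a x)}

theorem exists_mem_predualSet {X : Type*} [NormedAddCommGroup X] [NormedSpace ℂ X]
    (e : StrongDual ℂ X ≃ₗᵢ⋆[ℂ] A) (x : X) :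
    ∃ f ∈ predualSet e, ∀ a, f a = star (e.symm a x) := by
  let f : A →ₗ[ℂ] ℂ :=
    { toFun := fun a => star (e.symm a x)
      map_add' := fun a b => by simp
      map_smul' := fun c a => by simp [map_smulₛₗ] }
  have hf : ∀ a, ‖f a‖ ≤ ‖x‖ * ‖a‖ := fun a => by
    change ‖star (e.symm a x)‖ ≤ _
    rw [norm_star, mul_comm, ← e.symm.norm_map a]
    exact (e.symm a).le_opNorm x
  exact ⟨f.mkContinuous _ hf, ⟨x, fun _ => rfl⟩, fun _ => rfl⟩

/-- This is Banach–Alaoglu transported along `e`; the conjugation is harmless since `star` is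
continuous. -/
theorem isPredual_predualSet {X : Type*} [NormedAddCommGroup X] [NormedSpace ℂ X]
    (e : StrongDual ℂ X ≃ₗᵢ⋆[ℂ] A) : IsPredual (predualSet e) where
  exists_lim U r hU := by
    let w : A → WeakDual ℂ X := fun a => StrongDual.toWeakDual (e.symm a)
    have hK := WeakDual.isCompact_closedBall (𝕜 := ℂ) (0 : StrongDual ℂ X) r
    obtain ⟨φ, hφ, hlim⟩ := hK.ultrafilter_le_nhds (U.map w) (by
      rw [le_principal_iff]
      change ∀ᶠ a in (U : Filter A), w a ∈ _
      filter_upwards [hU] with a ha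
      simpa [w] using ha)
    refine ⟨e (WeakDual.toStrongDual φ), ?_, ?_⟩
    · rw [e.norm_map]
      simpa using hφ
    · rintro f ⟨x, hx⟩
      have h1 : Tendsto w (U : Filter A) (𝓝 φ) := hlim
      have h2 := ((WeakDual.eval_continuous x).tendsto φ).comp h1
      have h3 := (continuous_star.tendsto _).comp h2
      simp only [hx, LinearIsometryEquiv.symm_apply_apply]
      exact h3
  eq_zero a ha := by
    have : e.symm a = 0 := by
      ext x
      obtain ⟨f, hf, hfx⟩ := exists_mem_predualSet e x
      have := ha f hf
      rw [hfx, star_eq_zero] at this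
      simpa using this
    simpa using this

namespace WeakLim

variable {M : Set (StrongDual ℂ A)} {ι : Type*} {l : Filter ι} {x y : ι → A} {a b : A}

theorem add (hx : WeakLim M l x a) (hy : WeakLim M l y b) :
    WeakLim M l (fun i => x i + y i) (a + b) := fun f hf => by
  simpa only [map_add] using (hx f hf).add (hy f hf)

theorem const_smul (c : ℂ) (hx : WeakLim M l x a) :
    WeakLim M l (fun i => c • x i) (c • a) := fun f hf => by
  simpa only [map_smul] using (hx f hf).const_smul c

theorem sub (hx : WeakLim M l x a) (hy : WeakLim M l y b) :
    WeakLim M l (fun i => x i - y i) (a - b) := fun f hf => by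
  simpa only [map_sub] using (hx f hf).sub (hy f hf)

theorem const (a : A) : WeakLim M l (fun _ => a) a := fun _ _ => tendsto_const_nhds

theorem unique [NeBot l] (hM : IsPredual M) (ha : WeakLim M l x a) (hb : WeakLim M l x b) :
    a = b :=
  sub_eq_zero.1 <| hM.eq_zero _ fun f hf => by
    rw [map_sub, sub_eq_zero]
    exact tendsto_nhds_unique (ha f hf) (hb f hf)

theorem congr (h : WeakLim M l x a) (hxy : ∀ᶠ i in l, x i = y i) : WeakLim M l y a :=
  fun f hf => (h f hf).congr' (hxy.mono fun i hi => by simp only [hi])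

end WeakLim

theorem norm_coe_realPart_le (a : A) : ‖(realPart a : A)‖ ≤ ‖a‖ := realPart.norm_le a

theorem norm_coe_imaginaryPart_le (a : A) : ‖(imaginaryPart a : A)‖ ≤ ‖a‖ :=
  imaginaryPart.norm_le a

theorem coe_imaginaryPart_add_I_smul_one (a : A) (n : ℝ) :
    (imaginaryPart (a + (Complex.I * n) • (1 : A)) : A) =
      (imaginaryPart a : A) + algebraMap ℝ A n := by
  have : (realPart ((n : ℂ) • (1 : A)) : A) = algebraMap ℝ A n := by
    rw [Complex.coe_smul, map_smul, selfAdjoint.val_smul,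
      IsSelfAdjoint.coe_realPart (IsSelfAdjoint.one A), Algebra.algebraMap_eq_smul_one]
  rw [map_add, mul_smul, imaginaryPart_I_smul, AddSubgroup.coe_add, this]

theorem IsSelfAdjoint.norm_add_I_smul_one_sq_le [Nontrivial A] {x : A} (hs : IsSelfAdjoint x)
    (n : ℝ) : ‖x + (Complex.I * n) • (1 : A)‖ ^ 2 ≤ ‖x‖ ^ 2 + n ^ 2 := by
  have h : star (x + (Complex.I * n) • (1 : A)) * (x + (Complex.I * n) • (1 : A)) =
      star x * x + (n ^ 2 : ℂ) • (1 : A) := by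
    have h1 : Complex.I * n * (Complex.I * n) = -(n ^ 2 : ℂ) := by
      linear_combination (n ^ 2 : ℂ) * Complex.I_sq
    simp only [star_add, star_smul, star_one, hs.star_eq, add_mul, mul_add, smul_mul_assoc,
      mul_smul_comm, one_mul, mul_one, star_mul', Complex.star_def, Complex.conj_I,
      Complex.conj_ofReal, neg_mul, neg_smul, smul_add, smul_neg, smul_smul, h1]
    abel
  rw [sq, ← CStarRing.norm_star_mul_self, h]
  refine (norm_add_le _ _).trans ?_
  rw [CStarRing.norm_star_mul_self, norm_smul, norm_one, mul_one, ← sq]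
  simp

namespace IsPredual

variable {M : Set (StrongDual ℂ A)} (hM : IsPredual M) {ι : Type*} {U : Ultrafilter ι}
  {x : ι → A} {a : A} {r : ℝ}

include hM

theorem exists_weakLim (hx : ∀ᶠ i in (U : Filter ι), ‖x i‖ ≤ r) :
    ∃ a, ‖a‖ ≤ r ∧ WeakLim M (U : Filter ι) x a :=
  hM.exists_lim (U.map x) r hx

theorem norm_le_of_weakLim (hx : ∀ᶠ i in (U : Filter ι), ‖x i‖ ≤ r)
    (h : WeakLim M (U : Filter ι) x a) : ‖a‖ ≤ r := by
  obtain ⟨b, hb, hlim⟩ := hM.exists_weakLim hx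
  rwa [h.unique hM hlim]

/-- For self-adjoint `x` the C⋆-identity gives `‖x + i n‖² ≤ ‖x‖² + n²`, and closedness of balls
carries this bound to `a`. A spectral value `t` of the imaginary part of `a` then satisfies `(t +
n)² ≤ r² + n²` for all real `n`, which forces `t = 0`. -/
theorem isSelfAdjoint_of_weakLim (hx : ∀ᶠ i in (U : Filter ι), ‖x i‖ ≤ r)
    (hsa : ∀ᶠ i in (U : Filter ι), IsSelfAdjoint (x i)) (h : WeakLim M (U : Filter ι) x a) :
    IsSelfAdjoint a := by
  rcases subsingleton_or_nontrivial A with _ | _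
  · exact Subsingleton.elim _ _
  have key : ∀ n : ℝ, ‖(imaginaryPart a : A) + algebraMap ℝ A n‖ ^ 2 ≤ r ^ 2 + n ^ 2 := fun n => by
    have h1 : WeakLim M (U : Filter ι) (fun i => x i + (Complex.I * n) • (1 : A))
        (a + (Complex.I * n) • (1 : A)) := h.add (WeakLim.const _)
    have h2 : ‖a + (Complex.I * n) • (1 : A)‖ ≤ √(r ^ 2 + n ^ 2) := by
      refine hM.norm_le_of_weakLim ?_ h1
      filter_upwards [hx, hsa] with i hi hs
      apply Real.le_sqrt_of_sq_le
      refine (hs.norm_add_I_smul_one_sq_le n).trans ?_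
      gcongr
    rw [← coe_imaginaryPart_add_I_smul_one, ← Real.le_sqrt (norm_nonneg _) (by positivity)]
    exact (norm_coe_imaginaryPart_le _).trans h2
  have hspec : ∀ t ∈ spectrum ℝ (imaginaryPart a : A), t = 0 := fun t ht => by
    by_contra h0
    have h1 : ∀ n : ℝ, (t + n) ^ 2 ≤ r ^ 2 + n ^ 2 := fun n => by
      have h2 : t + n ∈ spectrum ℝ (algebraMap ℝ A n + (imaginaryPart a : A)) :=
        spectrum.add_mem_add_iff.2 ht
      have h3 := spectrum.norm_le_norm_of_mem h2
      rw [add_comm (algebraMap ℝ A n)] at h3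
      rw [← sq_abs (t + n), ← Real.norm_eq_abs]
      exact (pow_le_pow_left₀ (norm_nonneg _) h3 2).trans (key n)
    -- This `n` makes the cross term `2 t n` equal to `r² + 1`.
    have := h1 ((r ^ 2 + 1) / (2 * t))
    have h4 : 2 * t * ((r ^ 2 + 1) / (2 * t)) = r ^ 2 + 1 := by field_simp
    nlinarith [sq_nonneg t]
  have hy0 : (imaginaryPart a : A) = 0 :=
    CFC.eq_zero_of_spectrum_subset_zero (R := ℝ) _ (fun t ht => hspec t ht) (imaginaryPart a).2
  rw [← realPart_add_I_smul_imaginaryPart a, hy0, smul_zero, add_zero]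
  exact (realPart a).2

/-- `M` is not assumed stable under adjoints. Instead, real and imaginary parts have weak limits by
compactness, these are self-adjoint, and uniqueness of limits identifies them with the parts of `a`.
-/
theorem weakLim_star (hx : ∀ᶠ i in (U : Filter ι), ‖x i‖ ≤ r)
    (h : WeakLim M (U : Filter ι) x a) :
    WeakLim M (U : Filter ι) (fun i => star (x i)) (star a) := by
  obtain ⟨b, -, hb⟩ := hM.exists_weakLim (x := fun i => (realPart (x i) : A)) (U := U) (r := r)
    (hx.mono fun i hi => (norm_coe_realPart_le _).trans hi)
  obtain ⟨c, -, hc⟩ := hM.exists_weakLim (x := fun i => (imaginaryPart (x i) : A)) (U := U) (r := r)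
    (hx.mono fun i hi => (norm_coe_imaginaryPart_le _).trans hi)
  have hbs := hM.isSelfAdjoint_of_weakLim (hx.mono fun i hi => (norm_coe_realPart_le _).trans hi)
    (Eventually.of_forall fun i => (realPart (x i)).2) hb
  have hcs := hM.isSelfAdjoint_of_weakLim (hx.mono fun i hi => (norm_coe_imaginaryPart_le _).trans hi)
    (Eventually.of_forall fun i => (imaginaryPart (x i)).2) hc
  have hsum : a = b + Complex.I • c := by
    refine h.unique hM ((hb.add (hc.const_smul Complex.I)).congr ?_)
    exact Eventually.of_forall fun i => realPart_add_I_smul_imaginaryPart (x i)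
  have h1 : star a = b - Complex.I • c := by
    rw [hsum, star_add, star_smul, hbs.star_eq, hcs.star_eq]
    simp [sub_eq_add_neg]
  rw [h1]
  refine (hb.sub (hc.const_smul Complex.I)).congr (Eventually.of_forall fun i => ?_)
  conv_rhs => rw [← realPart_add_I_smul_imaginaryPart (x i)]
  rw [star_add, star_smul, (realPart (x i)).2.star_eq, (imaginaryPart (x i)).2.star_eq]
  simp [sub_eq_add_neg]

/-- A self-adjoint `x` is positive as soon as `‖r - x‖ ≤ r`, and positive elements of norm at most
`r` satisfy this bound, which is stable under weak limits. -/
theorem nonneg_of_weakLim [PartialOrder A] [StarOrderedRing A]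
    (hx : ∀ᶠ i in (U : Filter ι), ‖x i‖ ≤ r) (h0 : ∀ᶠ i in (U : Filter ι), 0 ≤ x i)
    (h : WeakLim M (U : Filter ι) x a) : 0 ≤ a := by
  rcases subsingleton_or_nontrivial A with _ | _
  · exact (Subsingleton.elim _ _ : (0 : A) = a).le
  have hr : 0 ≤ r := by
    obtain ⟨i, hi⟩ := hx.exists
    exact (norm_nonneg _).trans hi
  have hsa := hM.isSelfAdjoint_of_weakLim hx (h0.mono fun i hi => hi.isSelfAdjoint) h
  have h1 : ‖algebraMap ℝ A r - a‖ ≤ r := by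
    refine hM.norm_le_of_weakLim ?_ ((WeakLim.const (algebraMap ℝ A r)).sub h)
    filter_upwards [hx, h0] with i hi h0i
    have h2 := (CStarAlgebra.mem_Icc_algebraMap_iff_norm_le hr).2 ⟨h0i, hi⟩
    exact ((CStarAlgebra.mem_Icc_algebraMap_iff_norm_le hr).1
      ⟨sub_nonneg.2 h2.2, sub_le_self _ h2.1⟩).2
  have h2 : IsSelfAdjoint (algebraMap ℝ A r - a) := (IsSelfAdjoint.algebraMap A (.all r)).sub hsa
  have h3 : algebraMap ℝ A r - a ≤ algebraMap ℝ A r :=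
    h2.le_algebraMap_norm_self.trans (algebraMap_mono A h1)
  exact sub_le_self_iff _ |>.1 h3

end IsPredual

end Predual

/-! ### Weak continuity of multiplication by a projection, and norm limits -/

section Multiplication

open Filter Topology

variable {A : Type u} [CStarAlgebra A]

namespace IsPredual

variable {M : Set (StrongDual ℂ A)} (hM : IsPredual M) {ι : Type*} {U : Ultrafilter ι}
  {x : ι → A} {a : A} {r : ℝ}

include hM

/-- The vectors `x i` and `n q a` have orthogonal ranges, so `‖x i + n q a‖² ≤ r² + n² ‖q a‖²`. In
the limit, compressing by `q` gives `(n + 1)² ‖q a‖² ≤ r² + n² ‖q a‖²` for every `n`, which is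
impossible unless `q a = 0`. -/
theorem mul_eq_zero_of_weakLim {p q : A} (hp : IsStarProjection p) (hq : IsStarProjection q)
    (hpq : p * q = 0) (hx : ∀ᶠ i in (U : Filter ι), ‖x i‖ ≤ r)
    (hpx : ∀ᶠ i in (U : Filter ι), p * x i = x i) (h : WeakLim M (U : Filter ι) x a) :
    q * a = 0 := by
  have hqp : q * p = 0 := by
    simpa [hp.isSelfAdjoint.star_eq, hq.isSelfAdjoint.star_eq] using congr_arg star hpq
  have key : ∀ n : ℕ, ((n + 1) * ‖q * a‖) ^ 2 ≤ r ^ 2 + n ^ 2 * ‖q * a‖ ^ 2 := fun n => by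
    have h1 : ‖a + (n : ℂ) • (q * a)‖ ≤ √(r ^ 2 + n ^ 2 * ‖q * a‖ ^ 2) := by
      refine hM.norm_le_of_weakLim ?_ (h.add (WeakLim.const ((n : ℂ) • (q * a))))
      filter_upwards [hx, hpx] with i hi hpi
      apply Real.le_sqrt_of_sq_le
      have h2 : star (x i + (n : ℂ) • (q * a)) * (x i + (n : ℂ) • (q * a)) =
          star (x i) * x i + ((n : ℂ) ^ 2) • (star (q * a) * (q * a)) := by
        have e1 : star (x i) * (q * a) = 0 := by
          rw [← hpi, star_mul, hp.isSelfAdjoint.star_eq, mul_assoc, ← mul_assoc p, hpq]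
          simp
        have e2 : star (q * a) * x i = 0 := by
          rw [← hpi, star_mul, hq.isSelfAdjoint.star_eq, mul_assoc, ← mul_assoc q, hqp]
          simp
        simp only [star_add, star_smul, add_mul, mul_add, smul_mul_assoc, mul_smul_comm, e1, e2,
          smul_zero, zero_add, add_zero, smul_smul, sq]
        simp
      rw [sq, ← CStarRing.norm_star_mul_self, h2]
      refine (norm_add_le _ _).trans ?_
      rw [norm_smul, CStarRing.norm_star_mul_self, CStarRing.norm_star_mul_self, ← sq, ← sq]
      have h3 : ‖(n : ℂ) ^ 2‖ = (n : ℝ) ^ 2 := by simp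
      rw [h3]
      gcongr
    have h2 : (n + 1) * ‖q * a‖ ≤ ‖a + (n : ℂ) • (q * a)‖ := by
      have e1 : q * (a + (n : ℂ) • (q * a)) = ((n + 1 : ℕ) : ℂ) • (q * a) := by
        rw [mul_add, mul_smul_comm, ← mul_assoc, hq.isIdempotentElem.eq]
        push_cast
        rw [add_smul, one_smul, add_comm]
      have e2 : ‖((n + 1 : ℕ) : ℂ) • (q * a)‖ = (n + 1) * ‖q * a‖ := by
        rw [norm_smul, Complex.norm_natCast]
        push_cast
        rfl
      rw [← e2, ← e1]
      refine (norm_mul_le _ _).trans ?_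
      exact mul_le_of_le_one_left (norm_nonneg _) hq.norm_le
    rw [← Real.le_sqrt (by positivity) (by positivity)]
    exact h2.trans h1
  by_contra h0
  have hpos : 0 < ‖q * a‖ ^ 2 := by
    have := norm_pos_iff.2 h0
    positivity
  obtain ⟨n, hn⟩ := exists_nat_gt (r ^ 2 / ‖q * a‖ ^ 2)
  rw [div_lt_iff₀ hpos] at hn
  have := key n
  have hn0 : (0 : ℝ) ≤ n := n.cast_nonneg
  nlinarith [mul_nonneg hn0 hpos.le]

/-- Compactness gives limits `y` of `p x i` and `z` of `(1 - p) x i`. The preceding lemma keeps `y`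
and `z` in the ranges of `p` and `1 - p`, so `a = y + z` yields `p a = y`. -/
theorem weakLim_projection_mul {p : A} (hp : IsStarProjection p)
    (hx : ∀ᶠ i in (U : Filter ι), ‖x i‖ ≤ r) (h : WeakLim M (U : Filter ι) x a) :
    WeakLim M (U : Filter ι) (fun i => p * x i) (p * a) := by
  have hq := hp.one_sub
  have hpq : p * (1 - p) = 0 := by rw [mul_sub, hp.isIdempotentElem.eq, mul_one, sub_self]
  have hqp : (1 - p) * p = 0 := by rw [sub_mul, hp.isIdempotentElem.eq, one_mul, sub_self]
  have bound : ∀ {e : A}, IsStarProjection e → ∀ᶠ i in (U : Filter ι), ‖e * x i‖ ≤ r := fun he =>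
    hx.mono fun i hi => (norm_mul_le _ _).trans
      ((mul_le_of_le_one_left (norm_nonneg _) he.norm_le).trans hi)
  obtain ⟨y, -, hy⟩ := hM.exists_weakLim (bound hp)
  obtain ⟨z, -, hz⟩ := hM.exists_weakLim (bound hq)
  have h1 : (1 - p) * y = 0 := hM.mul_eq_zero_of_weakLim hp hq hpq (bound hp)
    (Eventually.of_forall fun i => by rw [← mul_assoc, hp.isIdempotentElem.eq]) hy
  have h2 : p * z = 0 := hM.mul_eq_zero_of_weakLim hq hp hqp (bound hq)
    (Eventually.of_forall fun i => by rw [← mul_assoc, hq.isIdempotentElem.eq]) hz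
  have h3 : a = y + z := h.unique hM ((hy.add hz).congr (Eventually.of_forall fun i => by
    rw [← add_mul, add_sub_cancel, one_mul]))
  have h4 : p * a = y := by
    rw [h3, mul_add, h2, add_zero]
    rw [sub_mul, one_mul, sub_eq_zero] at h1
    exact h1.symm
  rwa [h4]

/-- Weak continuity on bounded families of left multiplication passes to norm limits. -/
theorem weakLim_mul_of_forall_exists {c : A}
    (hc : ∀ ε > 0, ∃ d, ‖c - d‖ ≤ ε ∧ WeakLim M (U : Filter ι) (fun i => d * x i) (d * a))
    (hx : ∀ᶠ i in (U : Filter ι), ‖x i‖ ≤ r) (h : WeakLim M (U : Filter ι) x a) :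
    WeakLim M (U : Filter ι) (fun i => c * x i) (c * a) := by
  have ha : ‖a‖ ≤ r := hM.norm_le_of_weakLim hx h
  have hr : 0 ≤ r := (norm_nonneg a).trans ha
  intro f hf
  rw [Metric.tendsto_nhds]
  intro ε hε
  have hB : 0 < 3 * (‖f‖ + 1) * (r + 1) := by positivity
  obtain ⟨d, hd, hlim⟩ := hc (ε / (3 * (‖f‖ + 1) * (r + 1))) (by positivity)
  have hbd : ∀ z : A, ‖z‖ ≤ r → ‖f (c * z) - f (d * z)‖ < ε / 3 := fun z hz => by
    rw [← map_sub, ← sub_mul]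
    have e1 := (f.le_opNorm ((c - d) * z)).trans
      (mul_le_mul_of_nonneg_left (norm_mul_le _ _) (norm_nonneg f))
    have e2 : ‖c - d‖ * ‖z‖ ≤ ε / (3 * (‖f‖ + 1) * (r + 1)) * r := by gcongr
    refine (e1.trans (mul_le_mul_of_nonneg_left e2 (norm_nonneg f))).trans_lt ?_
    rw [lt_div_iff₀ (by norm_num)]
    have e3 : ‖f‖ * (ε / (3 * (‖f‖ + 1) * (r + 1)) * r) * 3 =
        ε * ((‖f‖ * r) / ((‖f‖ + 1) * (r + 1))) := by
      field_simp
    rw [e3]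
    refine mul_lt_of_lt_one_right hε ?_
    rw [div_lt_one (by positivity)]
    nlinarith [norm_nonneg f]
  filter_upwards [hx, Metric.tendsto_nhds.1 (hlim f hf) (ε / 3) (by positivity)] with i hi hi2
  have e1 := hbd (x i) hi
  have e2 := hbd a ha
  rw [← dist_eq_norm] at e1 e2
  rw [dist_comm] at e2
  calc dist (f (c * x i)) (f (c * a)) ≤ dist (f (c * x i)) (f (d * x i)) +
        dist (f (d * x i)) (f (d * a)) + dist (f (d * a)) (f (c * a)) := dist_triangle4 _ _ _ _
    _ < ε := by linarith

end IsPredual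

end Multiplication

/-! ### Spectral projections and weak continuity of multiplication -/

section SpectralProjection

open Filter Topology

variable {A : Type u} [CStarAlgebra A] [PartialOrder A] [StarOrderedRing A]

/-- Here `c b c = (√b c)⋆ (√b c)`, so the hypothesis forces `√b c = 0`. -/
theorem mul_eq_zero_of_conjugate_nonpos {b c : A} (hb : 0 ≤ b) (hc : IsSelfAdjoint c)
    (h : c * b * c ≤ 0) : b * c = 0 := by
  have hs : CFC.sqrt b * CFC.sqrt b = b := CFC.sqrt_mul_sqrt_self b hb
  have hsa : star (CFC.sqrt b) = CFC.sqrt b := (CFC.sqrt_nonneg b).isSelfAdjoint.star_eq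
  have h1 : star (CFC.sqrt b * c) * (CFC.sqrt b * c) = c * b * c := by
    conv_rhs => rw [← hs]
    rw [star_mul, hsa, hc.star_eq]
    noncomm_ring
  have h2 : CFC.sqrt b * c = 0 := by
    rw [← CStarRing.star_mul_self_eq_zero_iff, h1]
    exact le_antisymm h (h1 ▸ star_mul_self_nonneg _)
  rw [← hs, mul_assoc, h2, mul_zero]

theorem IsSelfAdjoint.conjugate_mono {a b c : A} (hc : IsSelfAdjoint c) (hab : a ≤ b) :
    c * a * c ≤ c * b * c := by
  have := star_left_conjugate_le_conjugate hab c
  rwa [hc.star_eq] at this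

/-- Continuous functions that increase to the indicator function of `(0, ∞)`. -/
noncomputable def indicatorApprox (n : ℕ) (t : ℝ) : ℝ := max 0 (min 1 (2 ^ n * t - 1))

@[fun_prop]
theorem continuous_indicatorApprox (n : ℕ) : Continuous (indicatorApprox n) := by
  unfold indicatorApprox
  fun_prop

theorem indicatorApprox_nonneg (n : ℕ) (t : ℝ) : 0 ≤ indicatorApprox n t := le_max_left _ _

theorem indicatorApprox_le_one (n : ℕ) (t : ℝ) : indicatorApprox n t ≤ 1 :=
  max_le zero_le_one (min_le_left _ _)

theorem indicatorApprox_of_nonpos (n : ℕ) {t : ℝ} (ht : t ≤ 0) : indicatorApprox n t = 0 := by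
  have : (2 : ℝ) ^ n * t ≤ 0 := mul_nonpos_of_nonneg_of_nonpos (by positivity) ht
  exact max_eq_left ((min_le_right _ _).trans (by linarith))

theorem indicatorApprox_mono (t : ℝ) : Monotone fun n => indicatorApprox n t := by
  refine monotone_nat_of_le_succ fun n => ?_
  rcases le_total t 0 with ht | ht
  · simp [indicatorApprox_of_nonpos _ ht]
  · unfold indicatorApprox
    gcongr
    · norm_num
    · omega

/-- Each function equals `1` on the support of the previous one; this is what makes the supremum in
`exists_spectralProjection` idempotent. -/
theorem indicatorApprox_mul_succ (n : ℕ) (t : ℝ) :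
    indicatorApprox n t * indicatorApprox (n + 1) t = indicatorApprox n t := by
  rcases le_total (2 ^ n * t) 1 with ht | ht
  · have : indicatorApprox n t = 0 := max_eq_left ((min_le_right _ _).trans (by linarith))
    simp [this]
  · have : indicatorApprox (n + 1) t = 1 := by
      unfold indicatorApprox
      rw [min_eq_left (by rw [pow_succ]; linarith), max_eq_right zero_le_one]
    rw [this, mul_one]

theorem indicatorApprox_le_mul (n : ℕ) (t : ℝ) : indicatorApprox n t ≤ 2 ^ n * max t 0 := by
  refine max_le (by positivity) ((min_le_right _ _).trans ?_)
  have : 2 ^ n * t ≤ 2 ^ n * max t 0 := by gcongr; exact le_max_left _ _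
  linarith

theorem abs_sub_indicatorApprox_mul_le (n : ℕ) (t : ℝ) :
    |max t 0 - indicatorApprox n t * max t 0| ≤ 2 * (1 / 2) ^ n := by
  have h1 := indicatorApprox_nonneg n t
  have h2 := indicatorApprox_le_one n t
  have hp : (0 : ℝ) < (1 / 2) ^ n := by positivity
  have hpp : (2 : ℝ) ^ n * (1 / 2) ^ n = 1 := by rw [← mul_pow]; norm_num
  have hm : 0 ≤ max t 0 := le_max_right _ _
  rw [abs_of_nonneg (by nlinarith)]
  rcases le_total t (2 * (1 / 2) ^ n) with ht | ht
  · have : max t 0 ≤ 2 * (1 / 2) ^ n := max_le ht (by positivity)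
    nlinarith
  · have : indicatorApprox n t = 1 := by
      unfold indicatorApprox
      have h3 : (2 : ℝ) ^ n * (2 * (1 / 2) ^ n) ≤ 2 ^ n * t := by gcongr
      rw [min_eq_left (by nlinarith), max_eq_right zero_le_one]
    rw [this, one_mul, sub_self]
    positivity

namespace IsPredual

variable {M : Set (StrongDual ℂ A)} (hM : IsPredual M)

include hM

theorem le_of_weakLim {ι : Type*} {U : Ultrafilter ι} {x y : ι → A} {a b : A} {r : ℝ}
    (hx : ∀ᶠ i in (U : Filter ι), ‖x i‖ ≤ r) (hy : ∀ᶠ i in (U : Filter ι), ‖y i‖ ≤ r)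
    (hxy : ∀ᶠ i in (U : Filter ι), x i ≤ y i)
    (hxa : WeakLim M (U : Filter ι) x a) (hyb : WeakLim M (U : Filter ι) y b) : a ≤ b := by
  rw [← sub_nonneg]
  refine hM.nonneg_of_weakLim (r := r + r) ?_ (hxy.mono fun i hi => sub_nonneg.2 hi) (hyb.sub hxa)
  filter_upwards [hx, hy] with i hi hi'
  exact (norm_sub_le _ _).trans (add_le_add hi' hi)

/-- A bounded monotone family has a least upper bound, which is its weak limit. -/
theorem exists_isLUB_of_monotone {ι : Type*} [Preorder ι] [IsDirectedOrder ι] [Nonempty ι]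
    {x : ι → A} (hmono : Monotone x) (h0 : ∀ i, 0 ≤ x i) (h1 : ∀ i, x i ≤ 1) :
    ∃ (U : Ultrafilter ι) (e : A), WeakLim M (U : Filter ι) x e ∧ IsLUB (Set.range x) e := by
  have hx : ∀ i, ‖x i‖ ≤ 1 := fun i => (CStarAlgebra.norm_le_one_iff_of_nonneg _ (h0 i)).2 (h1 i)
  let U : Ultrafilter ι := Ultrafilter.of atTop
  have hU : (U : Filter ι) ≤ atTop := Ultrafilter.of_le _
  obtain ⟨e, -, he⟩ := hM.exists_weakLim (U := U) (Eventually.of_forall hx)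
  refine ⟨U, e, he, ?_, ?_⟩
  · rintro _ ⟨i, rfl⟩
    exact hM.le_of_weakLim (Eventually.of_forall fun _ => hx i) (Eventually.of_forall hx)
      (hU ((eventually_ge_atTop i).mono fun j hj => hmono hj)) (WeakLim.const _) he
  · intro b hb
    exact hM.le_of_weakLim (r := max 1 ‖b‖)
      (Eventually.of_forall fun i => (hx i).trans (le_max_left _ _))
      (Eventually.of_forall fun _ => le_max_right _ _)
      (Eventually.of_forall fun i => hb ⟨i, rfl⟩) he (WeakLim.const _)

/-- The spectral projection of a self-adjoint `k` for the interval `(0, ∞)`. -/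
theorem exists_spectralProjection {k : A} (hk : IsSelfAdjoint k) (hk1 : -1 ≤ k) (hk2 : k ≤ 1) :
    ∃ e : A, IsStarProjection e ∧ cfc (fun t : ℝ => max t 0) k ≤ e ∧
      cfc (fun t : ℝ => max (-t) 0) k ≤ 1 - e ∧
      ∀ f ∈ M, (∀ a, 0 ≤ a → 0 ≤ f a) → f (cfc (fun t : ℝ => max t 0) k) = 0 → f e = 0 := by
  set F : ℕ → A := fun n => cfc (indicatorApprox n) k with hF
  set kp := cfc (fun t : ℝ => max t 0) k with hkp
  set km := cfc (fun t : ℝ => max (-t) 0) k with hkm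
  have hspec1 : ∀ t ∈ spectrum ℝ k, t ≤ 1 := by
    have : k ≤ algebraMap ℝ A 1 := by simpa using hk2
    exact (le_algebraMap_iff_spectrum_le hk).1 this
  have hspec2 : ∀ t ∈ spectrum ℝ k, -1 ≤ t := by
    have : algebraMap ℝ A (-1) ≤ k := by simpa using hk1
    exact (algebraMap_le_iff_le_spectrum hk).1 this
  have hF0 : ∀ n, 0 ≤ F n := fun n => cfc_nonneg fun t _ => indicatorApprox_nonneg n t
  have hF1 : ∀ n, F n ≤ 1 := fun n => cfc_le_one _ _ fun t _ => indicatorApprox_le_one n t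
  have hFm : Monotone F := fun m n hmn => cfc_mono fun t _ => indicatorApprox_mono t hmn
  have hFF : ∀ n, F n * F (n + 1) = F n := fun n => by
    rw [hF, ← cfc_mul _ _ _]
    simp only [indicatorApprox_mul_succ]
  have hFsa : ∀ n, IsSelfAdjoint (F n) := fun n => (hF0 n).isSelfAdjoint
  obtain ⟨U, e, hlim, hub, hlub⟩ := hM.exists_isLUB_of_monotone hFm hF0 hF1
  have hFe : ∀ n, F n ≤ e := fun n => hub ⟨n, rfl⟩
  have he0 : 0 ≤ e := (hF0 0).trans (hFe 0)
  have he1 : e ≤ 1 := hlub (by rintro _ ⟨n, rfl⟩; exact hF1 n)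
  have hesa : IsSelfAdjoint e := he0.isSelfAdjoint
  -- Since `F (n + 1) ≤ e`, the element `F n (1 - e) F n` is at most `F n (1 - F (n + 1)) F n = 0`.
  have heF : ∀ n, e * F n = F n := fun n => by
    have h1 : F n * (1 - e) * F n ≤ F n * (1 - F (n + 1)) * F n :=
      (hFsa n).conjugate_mono (sub_le_sub_left (hFe _) _)
    have h2 : F n * (1 - F (n + 1)) * F n = 0 := by rw [mul_sub, hFF, mul_one, sub_self, zero_mul]
    have h3 := mul_eq_zero_of_conjugate_nonpos (sub_nonneg.2 he1) (hFsa n) (h1.trans h2.le)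
    rw [sub_mul, one_mul, sub_eq_zero] at h3
    exact h3.symm
  have hFe' : ∀ n, F n * e = F n := fun n => by
    simpa [hesa.star_eq, (hFsa n).star_eq] using congr_arg star (heF n)
  -- One inequality comes from `0 ≤ e ≤ 1`. For the other, `e * e` bounds every `F n = e (F n) e`
  -- from above, and `e` is the least upper bound.
  have hee : e * e = e := by
    refine le_antisymm ?_ (hlub ?_)
    · have := CStarAlgebra.pow_antitone he0 he1 (show 1 ≤ 2 by norm_num)
      simpa [sq] using this
    · rintro _ ⟨n, rfl⟩
      have := hesa.conjugate_mono (hF1 n)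
      rwa [heF, hFe', mul_one] at this
  have he : IsStarProjection e := ⟨hee, hesa⟩
  have hkp0 : 0 ≤ kp := cfc_nonneg fun t _ => le_max_right _ _
  have hkp1 : kp ≤ 1 := cfc_le_one _ _ fun t ht => max_le (hspec1 t ht) zero_le_one
  have hekp : (1 - e) * kp = 0 := by
    have key : ∀ n : ℕ, ‖(1 - e) * kp‖ ≤ 2 * (1 / 2) ^ n := fun n => by
      have h1 : (1 - e) * kp = (1 - e) * (kp - F n * kp) := by
        rw [mul_sub, ← mul_assoc _ (F n), sub_mul 1 e (F n), heF, one_mul, sub_self, zero_mul,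
          sub_zero]
      have h2 : ‖kp - F n * kp‖ ≤ 2 * (1 / 2) ^ n := by
        rw [hkp, hF, ← cfc_mul _ _ _, ← cfc_sub _ _ _]
        refine norm_cfc_le (by positivity) fun t _ => ?_
        exact abs_sub_indicatorApprox_mul_le n t
      rw [h1]
      refine (norm_mul_le _ _).trans ((mul_le_of_le_one_left (norm_nonneg _) ?_).trans h2)
      exact he.one_sub.norm_le
    have hlim0 : Tendsto (fun n : ℕ => (2 : ℝ) * (1 / 2) ^ n) atTop (𝓝 0) := by
      simpa using (tendsto_pow_atTop_nhds_zero_of_lt_one (r := (1 / 2 : ℝ)) (by norm_num)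
        (by norm_num)).const_mul 2
    exact norm_le_zero_iff.1 (ge_of_tendsto' hlim0 key)
  refine ⟨e, he, ?_, ?_, ?_⟩
  · have h1 : e * kp = kp := by
      rw [sub_mul, one_mul, sub_eq_zero] at hekp
      exact hekp.symm
    have h2 : kp * e = kp := by
      simpa [hesa.star_eq, hkp0.isSelfAdjoint.star_eq] using congr_arg star h1
    have := hesa.conjugate_mono hkp1
    rwa [h1, h2, mul_one, hee] at this
  -- It suffices that `1 - km` is an upper bound of the `F n`, which is a pointwise inequality on
  -- the spectrum, contained in `[-1, ∞)`.
  · rw [le_sub_comm]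
    refine hlub ?_
    rintro _ ⟨n, rfl⟩
    have h1 : (1 : A) - km = cfc (fun t : ℝ => 1 - max (-t) 0) k := by
      rw [cfc_sub _ _ _, cfc_const_one ℝ k]
    rw [h1]
    refine cfc_mono fun t ht => ?_
    have h2 := hspec2 t ht
    rcases le_total t 0 with h | h
    · rw [indicatorApprox_of_nonpos n h, max_eq_left (by linarith)]
      linarith
    · rw [max_eq_right (by linarith), sub_zero]
      exact indicatorApprox_le_one n t
  · intro f hf hpos h0
    have h1 : ∀ n, f (F n) = 0 := fun n => by
      refine le_antisymm ?_ (hpos _ (hF0 n))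
      have h2 : F n ≤ ((2 : ℝ) ^ n) • kp := by
        rw [hkp, ← cfc_const_mul _ _ _]
        exact cfc_mono fun t _ => indicatorApprox_le_mul n t
      have h3 := hpos _ (sub_nonneg.2 h2)
      rw [map_sub, ← Complex.coe_smul, map_smul, h0, smul_zero, zero_sub] at h3
      exact neg_nonneg.1 h3
    have h2 := hlim f hf
    simp only [h1] at h2
    exact (tendsto_nhds_unique h2 tendsto_const_nhds)

/-- This extracts the first binary digit of `h`: with `e` the spectral projection of `k = 2h - 1`
for `(0, ∞)`, one has `2h - e = k⁺ + (1 - e - k⁻)` and `1 - (2h - e) = k⁻ + (e - k⁺)`. -/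
theorem exists_projection_two_smul_sub {h : A} (h0 : 0 ≤ h) (h1 : h ≤ 1) :
    ∃ e : A, IsStarProjection e ∧ 0 ≤ (2 : ℝ) • h - e ∧ (2 : ℝ) • h - e ≤ 1 := by
  set k : A := (2 : ℝ) • h - 1 with hk
  have hksa : IsSelfAdjoint k := by
    rw [hk]
    exact ((IsSelfAdjoint.all (2 : ℝ)).smul h0.isSelfAdjoint).sub (.one A)
  have e1 : (2 : ℝ) • h ≤ (2 : ℝ) • (1 : A) := smul_le_smul_of_nonneg_left h1 (by norm_num)
  have e2 : 0 ≤ (2 : ℝ) • h := smul_nonneg (by norm_num) h0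
  rw [two_smul ℝ (1 : A)] at e1
  obtain ⟨e, he, hp, hm, -⟩ := hM.exists_spectralProjection hksa
    (by rw [hk, neg_le_sub_iff_le_add]; simpa using e2)
    (by rw [hk, sub_le_iff_le_add]; exact e1)
  have hdec : k = cfc (fun t : ℝ => max t 0) k - cfc (fun t : ℝ => max (-t) 0) k := by
    rw [← cfc_sub _ _ _]
    conv_lhs => rw [← cfc_id ℝ k]
    refine cfc_congr fun t _ => ?_
    rcases le_total t 0 with h | h
    · simp [max_eq_right h, max_eq_left (neg_nonneg.2 h)]
    · simp [max_eq_left h, max_eq_right (neg_nonpos.2 h)]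
  have hp0 : 0 ≤ cfc (fun t : ℝ => max t 0) k := cfc_nonneg fun t _ => le_max_right _ _
  have hm0 : 0 ≤ cfc (fun t : ℝ => max (-t) 0) k := cfc_nonneg fun t _ => le_max_right _ _
  have e3 : (2 : ℝ) • h = k + 1 := by rw [hk, sub_add_cancel]
  refine ⟨e, he, ?_, ?_⟩
  · have : (2 : ℝ) • h - e = cfc (fun t : ℝ => max t 0) k +
        (1 - e - cfc (fun t : ℝ => max (-t) 0) k) := by
      rw [e3]
      nth_rewrite 1 [hdec]
      abel
    rw [this]
    exact add_nonneg hp0 (sub_nonneg.2 hm)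
  · have : 1 - ((2 : ℝ) • h - e) = cfc (fun t : ℝ => max (-t) 0) k +
        (e - cfc (fun t : ℝ => max t 0) k) := by
      rw [e3]
      nth_rewrite 1 [hdec]
      abel
    rw [← sub_nonneg, this]
    exact add_nonneg hm0 (sub_nonneg.2 hp)

section Mul

variable {ι : Type*} {U : Ultrafilter ι} {x : ι → A} {a : A} {r : ℝ}

/-- Iterating the extraction of binary digits approximates `h` in norm by dyadic combinations of
projections, for which weak continuity is known. -/
theorem exists_approx_weakLim_mul (hx : ∀ᶠ i in (U : Filter ι), ‖x i‖ ≤ r)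
    (hlim : WeakLim M (U : Filter ι) x a) (n : ℕ) {h : A} (h0 : 0 ≤ h) (h1 : h ≤ 1) :
    ∃ d, ‖h - d‖ ≤ (1 / 2) ^ n ∧ WeakLim M (U : Filter ι) (fun i => d * x i) (d * a) := by
  induction n generalizing h with
  | zero =>
    refine ⟨0, ?_, ?_⟩
    · simpa using (CStarAlgebra.norm_le_one_iff_of_nonneg h h0).2 h1
    · simpa using WeakLim.const (M := M) (l := (U : Filter ι)) (0 : A)
  | succ n ih =>
    obtain ⟨e, he, h2, h3⟩ := hM.exists_projection_two_smul_sub h0 h1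
    obtain ⟨d, hd, hdlim⟩ := ih h2 h3
    refine ⟨(1 / 2 : ℂ) • (e + d), ?_, ?_⟩
    · have : h - (1 / 2 : ℂ) • (e + d) = (1 / 2 : ℂ) • ((2 : ℝ) • h - e - d) := by
        rw [← Complex.coe_smul, smul_sub, smul_sub, smul_smul, smul_add]
        norm_num
        abel
      rw [this, norm_smul, pow_succ']
      gcongr
      norm_num
    · simp only [smul_mul_assoc, add_mul]
      exact ((hM.weakLim_projection_mul he hx hlim).add hdlim).const_smul _

/-- Left multiplication is weakly continuous on bounded families. -/
theorem weakLim_mul_left (c : A) (hx : ∀ᶠ i in (U : Filter ι), ‖x i‖ ≤ r)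
    (hlim : WeakLim M (U : Filter ι) x a) :
    WeakLim M (U : Filter ι) (fun i => c * x i) (c * a) := by
  have hc : c ∈ Submodule.span ℂ {b : A | 0 ≤ b} := by
    rw [CStarAlgebra.span_nonneg]
    trivial
  induction hc using Submodule.span_induction with
  | zero => simpa using WeakLim.const (M := M) (l := (U : Filter ι)) (0 : A)
  | add b c _ _ hb hc => simpa only [add_mul] using hb.add hc
  | smul z b _ hb => simpa only [smul_mul_assoc] using hb.const_smul z
  | mem b hb =>
    have hb : 0 ≤ b := hb
    set t : ℝ := ‖b‖ + 1 with ht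
    have htpos : 0 < t := by positivity
    have h0 : 0 ≤ t⁻¹ • b := smul_nonneg (inv_nonneg.2 htpos.le) hb
    have h1 : t⁻¹ • b ≤ 1 := by
      rw [← CStarAlgebra.norm_le_one_iff_of_nonneg _ h0, norm_smul, norm_inv, Real.norm_of_nonneg
        htpos.le, inv_mul_le_one₀ htpos, ht]
      linarith
    have key : WeakLim M (U : Filter ι) (fun i => (t⁻¹ • b) * x i) ((t⁻¹ • b) * a) := by
      refine hM.weakLim_mul_of_forall_exists (fun ε hε => ?_) hx hlim
      obtain ⟨n, hn⟩ := exists_pow_lt_of_lt_one hε (show (1 / 2 : ℝ) < 1 by norm_num)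
      obtain ⟨d, hd, hdl⟩ := hM.exists_approx_weakLim_mul hx hlim n h0 h1
      exact ⟨d, hd.trans hn.le, hdl⟩
    have h2 : ∀ y : A, (t : ℂ) • ((t⁻¹ • b) * y) = b * y := fun y => by
      rw [Complex.coe_smul, smul_mul_assoc, smul_smul, mul_inv_cancel₀ htpos.ne', one_smul]
    simpa only [h2] using key.const_smul (t : ℂ)

/-- Right multiplication is weakly continuous on bounded families. -/
theorem weakLim_mul_right (c : A) (hx : ∀ᶠ i in (U : Filter ι), ‖x i‖ ≤ r)
    (hlim : WeakLim M (U : Filter ι) x a) :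
    WeakLim M (U : Filter ι) (fun i => x i * c) (a * c) := by
  -- Right multiplication by `c` is left multiplication by `star c` between two adjoints.
  have h1 := hM.weakLim_mul_left (star c) (r := r) (hx.mono fun i hi => by rwa [norm_star])
    (hM.weakLim_star hx hlim)
  have h2 := hM.weakLim_star (r := ‖star c‖ * r) ?_ h1
  · simpa using h2
  · filter_upwards [hx] with i hi
    refine (norm_mul_le _ _).trans ?_
    rw [norm_star (x i)]
    gcongr

end Mul

end IsPredual

end SpectralProjection

/-! ### Existence and uniqueness of the support projection -/

section SupportProjection

open Filter Topology

variable {A : Type u} [CStarAlgebra A]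

theorem NormalPositiveFunctional.exists_isPredual (ω : NormalPositiveFunctional A) :
    ∃ M : Set (StrongDual ℂ A), IsPredual M ∧ ω.toDual ∈ M := by
  obtain ⟨X, _, _, _, e, x, hx⟩ := ω.normal
  exact ⟨predualSet e, isPredual_predualSet e, x, hx⟩

variable [PartialOrder A] [StarOrderedRing A]

theorem mul_self_le_norm_smul {d : A} (hd : 0 ≤ d) : d * d ≤ ‖d‖ • d := by
  have hs : CFC.sqrt d * CFC.sqrt d = d := CFC.sqrt_mul_sqrt_self d hd
  have h1 := CStarAlgebra.star_left_conjugate_le_norm_smul (a := CFC.sqrt d)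
    (hb := hd.isSelfAdjoint)
  rw [(CFC.sqrt_nonneg d).isSelfAdjoint.star_eq, hs] at h1
  have h2 : CFC.sqrt d * d * CFC.sqrt d = d * d := by
    nth_rewrite 2 [← hs]
    rw [← mul_assoc, hs, mul_assoc, hs]
  rwa [h2] at h1

theorem le_projection_of_mul_eq {h e : A} (h0 : 0 ≤ h) (h1 : h ≤ 1) (he : IsStarProjection e)
    (hmul : h * (1 - e) = 0) : h ≤ e := by
  have e1 : h * e = h := by
    rw [mul_sub, mul_one, sub_eq_zero] at hmul
    exact hmul.symm
  have e2 : e * h = h := by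
    simpa [he.isSelfAdjoint.star_eq, h0.isSelfAdjoint.star_eq] using congr_arg star e1
  have := he.isSelfAdjoint.conjugate_mono h1
  rwa [e2, e1, mul_one, he.isIdempotentElem.eq] at this

/-- Compressing by `1 - e` kills the right-hand side, whatever `c` is. This makes the set of null
positive contractions directed. -/
theorem le_projection_of_le_smul {h e : A} (h0 : 0 ≤ h) (h1 : h ≤ 1) (he : IsStarProjection e)
    {c : ℝ} (hle : h ≤ c • e) : h ≤ e := by
  refine le_projection_of_mul_eq h0 h1 he ?_
  refine mul_eq_zero_of_conjugate_nonpos h0 he.one_sub.isSelfAdjoint ?_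
  have h2 := he.one_sub.isSelfAdjoint.conjugate_mono hle
  have h3 : (1 - e) * (c • e) * (1 - e) = 0 := by
    rw [mul_smul_comm, sub_mul, one_mul, he.isIdempotentElem.eq, sub_self, smul_zero, zero_mul]
  rwa [h3] at h2

namespace NormalPositiveFunctional

variable (ω : NormalPositiveFunctional A)

theorem toDual_nonneg {a : A} (ha : 0 ≤ a) : 0 ≤ ω.toDual a := by
  obtain ⟨b, rfl⟩ := CStarAlgebra.nonneg_iff_eq_star_mul_self.1 ha
  exact ω.nonneg b

/-- The functional as a positive linear map. -/
noncomputable def toPositiveLinearMap : A →ₚ[ℂ] ℂ :=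
  PositiveLinearMap.mk₀ ω.toDual.toLinearMap fun _ ha => ω.toDual_nonneg ha

theorem toPositiveLinearMap_apply (a : A) : ω.toPositiveLinearMap a = ω.toDual a := rfl

theorem toDual_mono {a b : A} (h : a ≤ b) : ω.toDual a ≤ ω.toDual b :=
  OrderHomClass.mono ω.toPositiveLinearMap h

theorem toDual_star (a : A) : ω.toDual (star a) = star (ω.toDual a) :=
  map_star ω.toPositiveLinearMap a

/-- This is Cauchy–Schwarz for the GNS semi-inner product. -/
theorem toDual_star_mul_eq_zero (a : A) {b : A} (hb : ω.toDual (star b * b) = 0) :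
    ω.toDual (star a * b) = 0 := by
  set f := ω.toPositiveLinearMap
  have h := norm_inner_le_norm (𝕜 := ℂ) (f.toPreGNS a) (f.toPreGNS b)
  rw [f.preGNS_inner_def, f.preGNS_norm_def (f.toPreGNS b)] at h
  simp only [f.ofPreGNS_toPreGNS, f, toPositiveLinearMap_apply] at h
  rw [hb] at h
  simpa using h

theorem toDual_mul_eq_zero (a : A) {b : A} (hb : ω.toDual (star b * b) = 0) :
    ω.toDual (a * b) = 0 := by
  simpa using ω.toDual_star_mul_eq_zero (star a) hb

/-- The element `d = p x⋆ x p` satisfies `ω(d) = ω(x⋆ x) = 0` and `d² ≤ ‖d‖ d`, so faithfulness on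
the corner gives `d = (x p)⋆ (x p) = 0`. -/
theorem eq_zero_of_isSupportProjection {p : A} (hp : ω.IsSupportProjection p) {x : A}
    (hx : ω.toDual (star x * x) = 0) : x * p = 0 := by
  obtain ⟨hproj, h1, h2⟩ := hp
  have hsa := hproj.isSelfAdjoint.star_eq
  set d := p * (star x * x) * p with hd
  have hd0 : 0 ≤ d := by
    have := star_left_conjugate_nonneg (star_mul_self_nonneg x) p
    rwa [hsa] at this
  have h3 : ω.toDual (star d * d) = 0 := by
    have h4 : star d * d ≤ ‖d‖ • d := by
      rw [hd0.isSelfAdjoint.star_eq]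
      exact mul_self_le_norm_smul hd0
    refine le_antisymm ((ω.toDual_mono h4).trans ?_) (ω.nonneg d)
    rw [← Complex.coe_smul, map_smul, hd, ← (h1 _).2.2, hx, smul_zero]
  have h4 := h2 (star x * x) h3
  rw [← CStarRing.star_mul_self_eq_zero_iff, star_mul, hsa]
  rw [← h4]
  noncomm_ring

/-- Since `ω(1 - p') = 0`, the preceding lemma gives `p = p' p`; exchanging the roles and taking
adjoints gives `p' = p' p`. -/
theorem isSupportProjection_unique {p p' : A} (hp : ω.IsSupportProjection p)
    (hp' : ω.IsSupportProjection p') : p = p' := by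
  have key : ∀ {p p' : A}, ω.IsSupportProjection p → ω.IsSupportProjection p' →
      p = p' * p := fun {p p'} hp hp' => by
    have h1 : ω.toDual (star (1 - p') * (1 - p')) = 0 := by
      rw [hp'.1.one_sub.isSelfAdjoint.star_eq, hp'.1.one_sub.isIdempotentElem.eq, map_sub]
      have := (hp'.2.1 1).1
      rw [one_mul] at this
      rw [this, sub_self]
    have h2 := ω.eq_zero_of_isSupportProjection hp h1
    rwa [sub_mul, one_mul, sub_eq_zero] at h2
  have h1 := key hp hp'
  have h2 := congr_arg star (key hp' hp)
  rw [star_mul, hp.1.isSelfAdjoint.star_eq, hp'.1.isSelfAdjoint.star_eq] at h2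
  rw [h2, ← h1]

variable {M : Set (StrongDual ℂ A)} (hM : IsPredual M) (hω : ω.toDual ∈ M)

include hM hω

theorem exists_projection_ge {h : A} (h0 : 0 ≤ h) (h1 : h ≤ 1) (hh : ω.toDual h = 0) :
    ∃ e : A, IsStarProjection e ∧ h ≤ e ∧ ω.toDual e = 0 := by
  have h3 : cfc (fun t : ℝ => max t 0) h = h := by
    conv_rhs => rw [← cfc_id ℝ h]
    refine cfc_congr fun t ht => ?_
    exact max_eq_left (spectrum_nonneg_of_nonneg h0 ht)
  obtain ⟨e, he, h2, -, h4⟩ := hM.exists_spectralProjection h0.isSelfAdjoint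
    ((neg_nonpos.2 zero_le_one).trans h0) h1
  rw [h3] at h2 h4
  exact ⟨e, he, h2, h4 _ hω (fun _ ha => ω.toDual_nonneg ha) hh⟩

/-- For null positive contractions `h` and `k`, a null projection `e ≥ (h + k) / 2` dominates both,
so these contractions form a directed set. Its supremum `q` is a weak limit, hence null because `ω ∈
M`; a null projection above `q` belongs to the set and so equals `q`. -/
theorem exists_greatest_null_projection :
    ∃ q : A, IsStarProjection q ∧ ω.toDual q = 0 ∧
      ∀ h, 0 ≤ h → h ≤ 1 → ω.toDual h = 0 → h ≤ q := by
  let S := {h : A // 0 ≤ h ∧ h ≤ 1 ∧ ω.toDual h = 0}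
  have hne : Nonempty S := ⟨⟨0, le_rfl, zero_le_one, map_zero _⟩⟩
  have hdir : IsDirectedOrder S := ⟨by
    rintro ⟨h, h0, h1, h2⟩ ⟨k, k0, k1, k2⟩
    have hm0 : 0 ≤ (1 / 2 : ℝ) • (h + k) := smul_nonneg (by norm_num) (add_nonneg h0 k0)
    have hm1 : (1 / 2 : ℝ) • (h + k) ≤ 1 := by
      have := smul_le_smul_of_nonneg_left (add_le_add h1 k1) (show (0 : ℝ) ≤ 1 / 2 by norm_num)
      refine this.trans_eq ?_
      rw [← two_smul ℝ (1 : A), smul_smul]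
      norm_num
    have hm2 : ω.toDual ((1 / 2 : ℝ) • (h + k)) = 0 := by
      rw [← Complex.coe_smul, map_smul, map_add, h2, k2]
      simp
    obtain ⟨e, he, hle, he0⟩ := ω.exists_projection_ge hM hω hm0 hm1 hm2
    have h3 : h + k ≤ (2 : ℝ) • e := by
      have := smul_le_smul_of_nonneg_left hle (show (0 : ℝ) ≤ 2 by norm_num)
      rw [smul_smul] at this
      norm_num at this
      exact this
    refine ⟨⟨e, he.nonneg, sub_nonneg.1 he.one_sub.nonneg, he0⟩, ?_, ?_⟩
    · exact le_projection_of_le_smul (A := A) h0 h1 he ((le_add_of_nonneg_right k0).trans h3)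
    · exact le_projection_of_le_smul (A := A) k0 k1 he ((le_add_of_nonneg_left h0).trans h3)⟩
  obtain ⟨U, q, hlim, hub, hlub⟩ := hM.exists_isLUB_of_monotone (x := fun s : S => (s : A))
    (fun _ _ h => h) (fun s => s.2.1) (fun s => s.2.2.1)
  have hq : ∀ h, 0 ≤ h → h ≤ 1 → ω.toDual h = 0 → h ≤ q := fun h h0 h1 h2 =>
    hub ⟨⟨h, h0, h1, h2⟩, rfl⟩
  have hq0 : ω.toDual q = 0 := by
    have h1 := hlim _ hω
    have h2 : (fun s : S => ω.toDual (s : A)) = fun _ => 0 := funext fun s => s.2.2.2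
    rw [h2] at h1
    exact tendsto_nhds_unique h1 tendsto_const_nhds
  obtain ⟨e, he, hle, he0⟩ := ω.exists_projection_ge hM hω (hq 0 le_rfl zero_le_one (map_zero _))
    (hlub (by rintro _ ⟨s, rfl⟩; exact s.2.2.1)) hq0
  have hqe : q = e := le_antisymm hle
    (hq e he.nonneg (sub_nonneg.1 he.one_sub.nonneg) he0)
  exact ⟨q, hqe ▸ he, hq0, hq⟩

theorem exists_isSupportProjection : ∃ p : A, ω.IsSupportProjection p := by
  obtain ⟨q, hq, hq0, hmax⟩ := ω.exists_greatest_null_projection hM hω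
  have hsa := hq.isSelfAdjoint.star_eq
  have hr : ∀ a, ω.toDual (a * q) = 0 := fun a => by
    refine ω.toDual_mul_eq_zero a ?_
    rw [hsa, hq.isIdempotentElem.eq, hq0]
  have hl : ∀ a, ω.toDual (q * a) = 0 := fun a => by
    have h1 : star (star a * q) = q * a := by rw [star_mul, star_star, hsa]
    rw [← h1, toDual_star, hr, star_zero]
  refine ⟨1 - q, hq.one_sub, fun a => ⟨?_, ?_, ?_⟩, fun a ha => ?_⟩
  · rw [mul_sub, mul_one, map_sub, hr, sub_zero]
  · rw [sub_mul, one_mul, map_sub, hl, sub_zero]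
  · rw [mul_sub, mul_one, map_sub, hr, sub_zero, sub_mul, one_mul, map_sub, hl, sub_zero]
  -- A normalised multiple `h` of `x⋆ x` is null, so `h ≤ q`; but `h` is fixed by compression to `1
  -- - q`, which kills `q`.
  · set x := (1 - q) * a * (1 - q) with hx
    have hxq : x * (1 - q) = x := by
      rw [hx, mul_assoc, hq.one_sub.isIdempotentElem.eq]
    set t : ℝ := ‖star x * x‖ + 1 with ht
    have htpos : 0 < t := by positivity
    set h := t⁻¹ • (star x * x) with hh
    have hh0 : 0 ≤ h := smul_nonneg (inv_nonneg.2 htpos.le) (star_mul_self_nonneg x)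
    have hh1 : h ≤ 1 := by
      rw [← CStarAlgebra.norm_le_one_iff_of_nonneg _ hh0, norm_smul, norm_inv,
        Real.norm_of_nonneg htpos.le, inv_mul_le_one₀ htpos, ht]
      linarith
    have hh2 : ω.toDual h = 0 := by
      rw [hh, ← Complex.coe_smul, map_smul, ha, smul_zero]
    have h1 := hmax h hh0 hh1 hh2
    have h2 := hq.one_sub.isSelfAdjoint.conjugate_mono h1
    have h3 : (1 - q) * q * (1 - q) = 0 := by
      rw [sub_mul, one_mul, hq.isIdempotentElem.eq, sub_self, zero_mul]
    have h4 : (1 - q) * h * (1 - q) = h := by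
      have h5 : (1 - q) * star x = star x := by
        simpa [hsa] using congr_arg star hxq
      rw [hh, mul_smul_comm, smul_mul_assoc, ← mul_assoc, h5, mul_assoc, hxq]
    rw [h3, h4] at h2
    have h6 : h = 0 := le_antisymm h2 hh0
    rw [hh, smul_eq_zero_iff_right (inv_ne_zero htpos.ne')] at h6
    exact (CStarRing.star_mul_self_eq_zero_iff x).1 h6

end NormalPositiveFunctional

end SupportProjection

/-! ### The J-Hilbert space and absolutely continuous functionals -/

section AbsolutelyContinuous

open Filter Topology

variable {A : Type u} [CStarAlgebra A]

namespace NormalPositiveFunctional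

variable (ω : NormalPositiveFunctional A)

theorem eta_self_apply (a : selfAdjoint A) : ω.eta a a = (ω.toDual ((a : A) * a)).re := by
  have h : (jordanProd a a : A) = (a : A) * a := by
    simp only [jordanProd, ← two_smul ℝ ((a : A) * a), smul_smul]
    norm_num
  rw [eta_apply, h]

theorem eta_one_apply (a : selfAdjoint A) : ω.eta a 1 = (ω.toDual (a : A)).re := by
  have h : (jordanProd a 1 : A) = a := by
    simp only [jordanProd, selfAdjoint.val_one, mul_one, one_mul, ← two_smul ℝ (a : A), smul_smul]
    norm_num
  rw [eta_apply, h]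

theorem eta_sq_le (a b : selfAdjoint A) : ω.eta a b ^ 2 ≤ ω.eta a a * ω.eta b b := by
  let B : LinearMap.BilinForm ℝ (selfAdjoint A) := ContinuousLinearMap.coeLM ℝ ∘ₗ ω.eta
  have key := LinearMap.BilinForm.apply_mul_apply_le_of_forall_zero_le B
    (fun x => ω.eta_self_nonneg x) a b
  change ω.eta a b * ω.eta b a ≤ ω.eta a a * ω.eta b b at key
  rwa [ω.eta_comm b a, ← sq] at key

theorem toDual_re_sq_le (x : selfAdjoint A) :
    (ω.toDual (x : A)).re ^ 2 ≤ ω.eta x x * (ω.toDual 1).re := by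
  have h := ω.eta_sq_le x 1
  rw [eta_one_apply, ω.eta_one_apply 1] at h
  exact h

theorem eta_self_le (a : selfAdjoint A) : ω.eta a a ≤ ‖ω.toDual‖ * ‖a‖ ^ 2 := by
  rw [eta_self_apply]
  refine (Complex.re_le_norm _).trans ((ω.toDual.le_opNorm _).trans ?_)
  have h : ‖(a : A) * a‖ ≤ ‖a‖ ^ 2 := by
    rw [sq]
    exact norm_mul_le _ _
  gcongr

theorem etaPreJ_surjective : Function.Surjective ω.etaPreJ := fun ξ => ⟨ω.rep ξ, by
  apply ω.ofPreJ.injective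
  exact Subtype.ext (ω.eta_rep ξ)⟩

theorem norm_etaPreJ_sq (a : selfAdjoint A) : ‖ω.etaPreJ a‖ ^ 2 = ω.eta a a := by
  rw [← real_inner_self_eq_norm_sq, inner_etaPreJ, eta_apply]

/-- The map `a ↦ η_a` from the self-adjoint part of `A` to the J-Hilbert space. -/
noncomputable def etaHilbert : selfAdjoint A →L[ℝ] ω.JHilbert :=
  UniformSpace.Completion.toComplL ∘L
    ω.etaPreJ.mkContinuous √‖ω.toDual‖ (fun a => by
      rw [← Real.sqrt_sq (norm_nonneg (ω.etaPreJ a)), ← Real.sqrt_sq (norm_nonneg a),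
        ← Real.sqrt_mul (norm_nonneg _), norm_etaPreJ_sq]
      exact Real.sqrt_le_sqrt (ω.eta_self_le a))

theorem etaHilbert_apply (a : selfAdjoint A) :
    ω.etaHilbert a = (ω.etaPreJ a : ω.JHilbert) := rfl

theorem inner_etaHilbert (a b : selfAdjoint A) :
    inner ℝ (ω.etaHilbert a) (ω.etaHilbert b) = ω.eta a b := by
  rw [etaHilbert_apply, etaHilbert_apply, UniformSpace.Completion.inner_coe, inner_etaPreJ,
    eta_apply]

theorem norm_etaHilbert_sq (a : selfAdjoint A) : ‖ω.etaHilbert a‖ ^ 2 = ω.eta a a := by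
  rw [← real_inner_self_eq_norm_sq, inner_etaHilbert]

theorem denseRange_etaHilbert : DenseRange ω.etaHilbert :=
  (UniformSpace.Completion.denseRange_coe (α := ω.PreJ)).comp ω.etaPreJ_surjective.denseRange
    (UniformSpace.Completion.continuous_coe _)

/-- The functional `a ↦ G_ω(η, η_a)` is absolutely continuous with respect to `ω`. -/
theorem innerSL_comp_etaHilbert_mem_AC (η : ω.JHilbert) :
    innerSL ℝ η ∘L ω.etaHilbert ∈ ω.AC := by
  let _ := CStarAlgebra.spectralOrder A
  have := CStarAlgebra.spectralOrderedRing A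
  intro ε hε
  -- For a positive contraction `a`, `‖η_a‖² = ω(a²) ≤ ω(a)`, so this bound on `ω(a)` gives `‖η_a‖ <
  -- ε / (‖η‖ + 1)`.
  refine ⟨(ε / (‖η‖ + 1)) ^ 2, by positivity, fun b hb hlt => ?_⟩
  set a : selfAdjoint A := ⟨star b * b, IsSelfAdjoint.star_mul_self b⟩ with ha
  have h1 : ω.eta a a < (ε / (‖η‖ + 1)) ^ 2 := by
    refine lt_of_le_of_lt ?_ hlt
    rw [eta_self_apply]
    have h2 : star b * b * (star b * b) ≤ star b * b := by
      refine (mul_self_le_norm_smul (star_mul_self_nonneg b)).trans ?_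
      have := smul_le_smul_of_nonneg_right hb (star_mul_self_nonneg b)
      rwa [one_smul] at this
    exact (Complex.le_def.1 (ω.toDual_mono h2)).1
  rw [← norm_etaHilbert_sq] at h1
  have h2 : ‖ω.etaHilbert a‖ < ε / (‖η‖ + 1) := lt_of_pow_lt_pow_left₀ 2 (by positivity) h1
  rw [lt_div_iff₀ (by positivity)] at h2
  have h3 : |inner ℝ η (ω.etaHilbert a)| ≤ ‖η‖ * ‖ω.etaHilbert a‖ := abs_real_inner_le_norm _ _
  change |inner ℝ η (ω.etaHilbert a)| < ε
  nlinarith [norm_nonneg (ω.etaHilbert a)]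

/-- The inclusion of the J-Hilbert space in the space of absolutely continuous functionals. -/
noncomputable def inclusionAC : ω.JHilbert →L[ℝ] ω.AC :=
  ContinuousLinearMap.codRestrict
    (((ContinuousLinearMap.compL ℝ (selfAdjoint A) ω.JHilbert ℝ).flip ω.etaHilbert) ∘L
      (innerSL ℝ : ω.JHilbert →L[ℝ] ω.JHilbert →L[ℝ] ℝ))
    ω.AC ω.innerSL_comp_etaHilbert_mem_AC

theorem inclusionAC_apply (η : ω.JHilbert) (a : selfAdjoint A) :
    (ω.inclusionAC η : StrongDual ℝ (selfAdjoint A)) a = inner ℝ η (ω.etaHilbert a) := rfl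

theorem inclusionAC_etaHilbert (a : selfAdjoint A) :
    (ω.inclusionAC (ω.etaHilbert a) : StrongDual ℝ (selfAdjoint A)) = ω.eta a := by
  ext b
  rw [inclusionAC_apply, inner_etaHilbert]

theorem inclusionAC_injective : Function.Injective ω.inclusionAC := by
  rw [injective_iff_map_eq_zero]
  intro η hη
  refine ω.denseRange_etaHilbert.eq_zero_of_inner_left ℝ ?_
  intro a
  rw [← inclusionAC_apply, hη]
  rfl

section Order

variable [PartialOrder A] [StarOrderedRing A]

theorem abs_apply_lt_of_nonneg {η : StrongDual ℝ (selfAdjoint A)} {ε δ : ℝ}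
    (h : ∀ b : A, ‖star b * b‖ ≤ 1 → (ω.toDual (star b * b)).re < δ →
      |η ⟨star b * b, IsSelfAdjoint.star_mul_self b⟩| < ε)
    (x : selfAdjoint A) (hx0 : 0 ≤ (x : A)) (hx1 : ‖x‖ ≤ 1) (hx : (ω.toDual (x : A)).re < δ) :
    |η x| < ε := by
  obtain ⟨b, hb⟩ := CStarAlgebra.nonneg_iff_eq_star_mul_self.1 hx0
  have h1 := h b (by rw [← hb]; exact hx1) (by rwa [← hb])
  have h2 : x = ⟨star b * b, IsSelfAdjoint.star_mul_self b⟩ := Subtype.ext hb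
  rwa [h2]

theorem eta_self_le_of_mul_self_le {x y : selfAdjoint A} (h : (x : A) * x ≤ y * y) :
    ω.eta x x ≤ ω.eta y y := by
  rw [eta_self_apply, eta_self_apply]
  exact (Complex.le_def.1 (ω.toDual_mono h)).1

/-- Absolute continuity only tests positive elements, so it is applied to `a⁺` and `a⁻`. Their
squares are at most `a²`, and Cauchy–Schwarz against `1` gives `ω(a^±)² ≤ ω(a²) ω(1)`. -/
theorem exists_abs_lt_of_mem_AC_of_norm_le_one {η : StrongDual ℝ (selfAdjoint A)} (hη : η ∈ ω.AC)
    {ε : ℝ} (hε : 0 < ε) :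
    ∃ δ > 0, ∀ a : selfAdjoint A, ‖a‖ ≤ 1 → ω.eta a a < δ → |η a| < ε := by
  obtain ⟨δ, hδ, h⟩ := hη (ε / 2) (half_pos hε)
  set W := (ω.toDual 1).re with hW
  have hW0 : 0 ≤ W := (Complex.le_def.1 (ω.toDual_nonneg zero_le_one)).1
  refine ⟨δ ^ 2 / (W + 1), by positivity, fun a ha hlt => ?_⟩
  rw [lt_div_iff₀ (by positivity)] at hlt
  have bound : ∀ x : selfAdjoint A, 0 ≤ (x : A) → ‖x‖ ≤ 1 → (x : A) * x ≤ a * a →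
      |η x| < ε / 2 := fun x hx0 hx1 hx => by
    refine ω.abs_apply_lt_of_nonneg h x hx0 hx1 ?_
    have h1 := ω.toDual_re_sq_le x
    have h2 := ω.eta_self_le_of_mul_self_le hx
    have h3 := ω.eta_self_nonneg a
    refine lt_of_pow_lt_pow_left₀ 2 hδ.le ?_
    nlinarith
  have hsq : (a : A) * a = (a : A)⁺ * (a : A)⁺ + (a : A)⁻ * (a : A)⁻ := by
    conv_lhs => rw [← CFC.posPart_sub_negPart (a : A) a.2]
    rw [sub_mul, mul_sub, mul_sub, CFC.posPart_mul_negPart, CFC.negPart_mul_posPart]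
    abel
  have hp0 : 0 ≤ (a : A)⁺ := CFC.posPart_nonneg _
  have hm0 : 0 ≤ (a : A)⁻ := CFC.negPart_nonneg _
  have hpp : 0 ≤ (a : A)⁺ * (a : A)⁺ := hp0.isSelfAdjoint.mul_self_nonneg
  have hmm : 0 ≤ (a : A)⁻ * (a : A)⁻ := hm0.isSelfAdjoint.mul_self_nonneg
  let p : selfAdjoint A := ⟨(a : A)⁺, hp0.isSelfAdjoint⟩
  let m : selfAdjoint A := ⟨(a : A)⁻, hm0.isSelfAdjoint⟩
  have hp := bound p hp0 ((CStarAlgebra.norm_posPart_le (a : A)).trans ha)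
    (by rw [hsq]; exact le_add_of_nonneg_right hmm)
  have hm := bound m hm0 ((CStarAlgebra.norm_negPart_le (a : A)).trans ha)
    (by rw [hsq]; exact le_add_of_nonneg_left hpp)
  have hapm : a = p - m := Subtype.ext (CFC.posPart_sub_negPart (a : A) a.2).symm
  rw [hapm, map_sub]
  exact (abs_sub _ _).trans_lt (by linarith)

/-- On bounded sets, an absolutely continuous functional is continuous for the J-norm. -/
theorem exists_abs_lt_of_mem_AC {η : StrongDual ℝ (selfAdjoint A)} (hη : η ∈ ω.AC)
    {r ε : ℝ} (hr : 0 < r) (hε : 0 < ε) :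
    ∃ δ > 0, ∀ a : selfAdjoint A, ‖a‖ ≤ r → ω.eta a a < δ → |η a| < ε := by
  obtain ⟨δ, hδ, h⟩ := ω.exists_abs_lt_of_mem_AC_of_norm_le_one hη (div_pos hε hr)
  refine ⟨r ^ 2 * δ, by positivity, fun a ha hlt => ?_⟩
  have h1 := h (r⁻¹ • a) (by
    rw [norm_smul, norm_inv, Real.norm_of_nonneg hr.le, inv_mul_le_one₀ hr]
    exact ha) (by
    rw [map_smul, map_smul, smul_apply, smul_eq_mul, smul_eq_mul, ← mul_assoc, ← sq,
      inv_pow, inv_mul_lt_iff₀ (by positivity)]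
    exact hlt)
  rw [map_smul, smul_eq_mul, abs_mul, abs_of_pos (inv_pos.2 hr), lt_div_iff₀ hr] at h1
  rwa [mul_comm, ← mul_assoc, mul_inv_cancel₀ hr.ne', one_mul] at h1

theorem apply_eq_zero_of_mem_AC {η : StrongDual ℝ (selfAdjoint A)} (hη : η ∈ ω.AC)
    {a : selfAdjoint A} (ha : ω.eta a a = 0) : η a = 0 := by
  rw [← abs_eq_zero]
  refine le_antisymm (le_of_forall_pos_lt_add fun ε hε => ?_) (abs_nonneg _)
  obtain ⟨δ, hδ, h⟩ := ω.exists_abs_lt_of_mem_AC hη (r := ‖a‖ + 1) (by positivity) hε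
  rw [zero_add]
  exact h a (by linarith) (ha ▸ hδ)

end Order

end NormalPositiveFunctional

end AbsolutelyContinuous

/-! ### Functionals on `AC_ω` as evaluations -/

section Duality

open Filter Topology

/-- A real functional on a subspace of the dual of `E` is approximated, on finite sets, by the
evaluations at points of `E` of norm at most that of the functional. -/
theorem exists_norm_le_forall_mem_abs_sub_lt {E : Type*} [NormedAddCommGroup E] [NormedSpace ℝ E]
    {S : Submodule ℝ (StrongDual ℝ E)} (F : StrongDual ℝ S) (s : Finset S) {ε : ℝ} (hε : 0 < ε) :
    ∃ a : E, ‖a‖ ≤ ‖F‖ ∧ ∀ η ∈ s, |F η - (η : StrongDual ℝ E) a| < ε := by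
  classical
  let T : E →L[ℝ] (s → ℝ) := ContinuousLinearMap.pi fun η => (η : S).1
  let v : s → ℝ := fun η => F η
  have hmem : v ∈ closure (T '' Metric.closedBall 0 ‖F‖) := by
    by_contra hv
    obtain ⟨f, u, h1, h2⟩ := geometric_hahn_banach_closed_point
      ((convex_closedBall (0 : E) ‖F‖).linear_image T.toLinearMap).closure isClosed_closure hv
    -- The separating functional `f` is encoded by one `η₀` in `S`, with `f (T a) = η₀ a` and `f v =
    -- F η₀`. Separation from the ball then says `‖F‖ ‖η₀‖ ≤ u < F η₀`, a contradiction.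
    set η₀ : S := ∑ η : s, f (Pi.single η 1) • (η : S) with hη₀
    have hf : ∀ w : s → ℝ, f w = ∑ η : s, f (Pi.single η 1) * w η := fun w => by
      conv_lhs => rw [← Finset.univ_sum_single w]
      rw [map_sum]
      refine Finset.sum_congr rfl fun η _ => ?_
      have : (Pi.single η (w η) : s → ℝ) = w η • Pi.single η 1 := by
        rw [← Pi.single_smul, smul_eq_mul, mul_one]
      rw [this, map_smul, smul_eq_mul, mul_comm]
    have hT : ∀ a, f (T a) = (η₀ : StrongDual ℝ E) a := fun a => by
      rw [hf, hη₀]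
      simp [T]
    have hF : f v = F η₀ := by
      rw [hf, hη₀]
      simp [v]
    have h3 : ∀ a : E, ‖a‖ ≤ ‖F‖ → (η₀ : StrongDual ℝ E) a < u := fun a ha => by
      rw [← hT]
      exact h1 _ (subset_closure ⟨a, by simpa using ha, rfl⟩)
    have hu : 0 < u := by simpa using h3 0 (by simp)
    have h4 : ‖F‖ * ‖η₀‖ ≤ u := by
      rcases (norm_nonneg F).eq_or_lt with h0 | h0
      · rw [← h0, zero_mul]
        exact hu.le
      · rw [mul_comm, ← le_div_iff₀ h0]
        refine ContinuousLinearMap.opNorm_le_bound _ (by positivity) fun x => ?_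
        rcases eq_or_ne x 0 with rfl | hx
        · simp
        have hx' : 0 < ‖x‖ := norm_pos_iff.2 hx
        have key : ∀ y : E, ‖y‖ = ‖x‖ → (η₀ : StrongDual ℝ E) y ≤ u / ‖F‖ * ‖x‖ := fun y hy => by
          have h5 := h3 ((‖F‖ / ‖x‖) • y) (by
            rw [norm_smul, norm_div, norm_norm, norm_norm, hy, div_mul_cancel₀ _ hx'.ne'])
          rw [map_smul, smul_eq_mul] at h5
          rw [div_mul_eq_mul_div, le_div_iff₀ h0]
          rw [div_mul_eq_mul_div, div_lt_iff₀ hx'] at h5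
          linarith
        rw [Real.norm_eq_abs, abs_le']
        refine ⟨key x rfl, ?_⟩
        have := key (-x) (norm_neg x)
        rwa [map_neg] at this
    have h5 := (le_abs_self _).trans (F.le_opNorm η₀)
    linarith
  obtain ⟨_, ⟨a, ha, rfl⟩, hlt⟩ := Metric.mem_closure_iff.1 hmem ε hε
  refine ⟨a, by simpa using ha, fun η hη => ?_⟩
  exact ((dist_le_pi_dist v (T a) ⟨η, hη⟩).trans_lt hlt)

variable {A : Type u} [CStarAlgebra A]

namespace NormalPositiveFunctional

variable (ω : NormalPositiveFunctional A) {M : Set (StrongDual ℂ A)}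

/-! ### Weak continuity of absolutely continuous functionals on bounded families -/

section WeakContinuity

variable (hM : IsPredual M) (hω : ω.toDual ∈ M) {ι : Type*} {U : Ultrafilter ι}
  {x : ι → selfAdjoint A} {a : selfAdjoint A} {r : ℝ}

include hM hω

theorem tendsto_eta (hx : ∀ᶠ i in (U : Filter ι), ‖x i‖ ≤ r)
    (hlim : WeakLim M (U : Filter ι) (fun i => (x i : A)) a) (b : selfAdjoint A) :
    Tendsto (fun i => ω.eta b (x i)) U (𝓝 (ω.eta b a)) := by
  let _ := CStarAlgebra.spectralOrder A
  have := CStarAlgebra.spectralOrderedRing A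
  have h1 := ((hM.weakLim_mul_left (b : A) hx hlim).add
    (hM.weakLim_mul_right (b : A) hx hlim)).const_smul ((1 / 2 : ℝ) : ℂ) _ hω
  have h2 := (Complex.continuous_re.tendsto _).comp h1
  simp only [Complex.coe_smul] at h2
  exact h2

/-- For `ξ = η_b` this is weak continuity of multiplication; the general case follows by density,
since the `η_y` with `‖y‖ ≤ r` are uniformly bounded. -/
theorem tendsto_inner_etaHilbert (hx : ∀ᶠ i in (U : Filter ι), ‖x i‖ ≤ r)
    (hlim : WeakLim M (U : Filter ι) (fun i => (x i : A)) a) (ξ : ω.JHilbert) :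
    Tendsto (fun i => inner ℝ ξ (ω.etaHilbert (x i))) U (𝓝 (inner ℝ ξ (ω.etaHilbert a))) := by
  have ha : ‖a‖ ≤ r := hM.norm_le_of_weakLim hx hlim
  have hr : 0 ≤ r := (norm_nonneg a).trans ha
  set C := ‖ω.etaHilbert‖ * r + 1 with hC
  have hC0 : 0 < C := by positivity
  have hb : ∀ y : selfAdjoint A, ‖y‖ ≤ r → ‖ω.etaHilbert y‖ ≤ C := fun y hy =>
    (ω.etaHilbert.le_opNorm y).trans (by
      have := mul_le_mul_of_nonneg_left hy (norm_nonneg ω.etaHilbert)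
      linarith)
  rw [Metric.tendsto_nhds]
  intro ε hε
  obtain ⟨b, hbξ⟩ := ω.denseRange_etaHilbert.exists_dist_lt ξ (show 0 < ε / (3 * C) by positivity)
  have hd : ∀ y : selfAdjoint A, ‖y‖ ≤ r →
      dist (inner ℝ ξ (ω.etaHilbert y)) (ω.eta b y) ≤ ε / 3 := fun y hy => by
    rw [← inner_etaHilbert, Real.dist_eq, ← inner_sub_left]
    refine (abs_real_inner_le_norm _ _).trans ?_
    rw [← dist_eq_norm]
    refine (mul_le_mul hbξ.le (hb y hy) (norm_nonneg _) (by positivity)).trans_eq ?_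
    field_simp
  filter_upwards [hx, Metric.tendsto_nhds.1 (ω.tendsto_eta hM hω hx hlim b) (ε / 3)
    (by positivity)] with i hi hi2
  have e1 := hd (x i) hi
  have e2 := hd a ha
  rw [dist_comm] at e2
  refine (dist_triangle4 _ _ _ _).trans_lt (?_ : _ + dist (ω.eta b (x i)) (ω.eta b a) + _ < ε)
  linarith

/-- This is Mazur's argument. The convex set `D` of `b` with `‖b‖ ≤ r` and `η b ≥ ε` has an image in
the J-Hilbert space that stays away from `0`, by absolute continuity. A functional separating it
strictly from `0` is an inner product by Riesz, hence tends to `0` along `x`, so `x` cannot remain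
in `D`. -/
theorem not_eventually_le_of_mem_AC {η : StrongDual ℝ (selfAdjoint A)} (hη : η ∈ ω.AC)
    (hx : ∀ᶠ i in (U : Filter ι), ‖x i‖ ≤ r)
    (hlim : WeakLim M (U : Filter ι) (fun i => (x i : A)) 0) {ε : ℝ} (hε : 0 < ε) :
    ¬ ∀ᶠ i in (U : Filter ι), ε ≤ η (x i) := by
  let _ := CStarAlgebra.spectralOrder A
  have := CStarAlgebra.spectralOrderedRing A
  intro hev
  have hr : 0 ≤ r := by
    obtain ⟨i, hi⟩ := hx.exists
    exact (norm_nonneg _).trans hi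
  obtain ⟨δ, hδ, h⟩ := ω.exists_abs_lt_of_mem_AC hη (r := r + 1) (by positivity) hε
  let D : Set (selfAdjoint A) := Metric.closedBall 0 r ∩ {b | ε ≤ η b}
  have hD : Convex ℝ D := (convex_closedBall _ _).inter
    (convex_halfSpace_ge η.toLinearMap.isLinear ε)
  have h0 : (0 : ω.JHilbert) ∉ closure (ω.etaHilbert '' D) := fun h0 => by
    obtain ⟨_, ⟨b, ⟨hb1, hb2⟩, rfl⟩, hlt⟩ := Metric.mem_closure_iff.1 h0 √δ (Real.sqrt_pos.2 hδ)
    rw [dist_zero_left, Real.lt_sqrt (norm_nonneg _), norm_etaHilbert_sq] at hlt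
    have hb3 : ‖b‖ ≤ r := by simpa using hb1
    have h1 := h b (by linarith) hlt
    have h2 : ε ≤ η b := hb2
    exact absurd (h2.trans (le_abs_self _)) (not_le.2 h1)
  obtain ⟨f, u, hu0, hu⟩ := geometric_hahn_banach_point_closed
    (hD.linear_image ω.etaHilbert.toLinearMap).closure isClosed_closure h0
  rw [map_zero] at hu0
  have hlim' : Tendsto (fun i => f (ω.etaHilbert (x i))) U (𝓝 0) := by
    have h1 := ω.tendsto_inner_etaHilbert hM hω (a := 0) hx hlim
      ((InnerProductSpace.toDual ℝ ω.JHilbert).symm f)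
    simpa only [InnerProductSpace.toDual_symm_apply, map_zero] using h1
  have hge : ∀ᶠ i in (U : Filter ι), u ≤ f (ω.etaHilbert (x i)) := by
    filter_upwards [hx, hev] with i hi hi2
    exact (hu _ (subset_closure ⟨x i, ⟨by simpa using hi, hi2⟩, rfl⟩)).le
  exact absurd (ge_of_tendsto hlim' hge) (not_le.2 hu0)

/-- Absolutely continuous functionals are weakly continuous on bounded families. -/
theorem tendsto_of_mem_AC {η : StrongDual ℝ (selfAdjoint A)} (hη : η ∈ ω.AC)
    (hx : ∀ᶠ i in (U : Filter ι), ‖x i‖ ≤ r)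
    (hlim : WeakLim M (U : Filter ι) (fun i => (x i : A)) a) :
    Tendsto (fun i => η (x i)) U (𝓝 (η a)) := by
  have hx' : ∀ᶠ i in (U : Filter ι), ‖x i - a‖ ≤ r + ‖a‖ := hx.mono fun i hi =>
    (norm_sub_le _ _).trans (by linarith)
  have hlim' : WeakLim M (U : Filter ι) (fun i => ((x i - a : selfAdjoint A) : A)) 0 := by
    simpa using hlim.sub (WeakLim.const (a : A))
  rw [Metric.tendsto_nhds]
  intro ε hε
  have h1 := Ultrafilter.eventually_not.2
    (ω.not_eventually_le_of_mem_AC hM hω hη hx' hlim' hε)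
  have h2 := Ultrafilter.eventually_not.2
    (ω.not_eventually_le_of_mem_AC hM hω (ω.AC.neg_mem hη) hx' hlim' hε)
  filter_upwards [h1, h2] with i hi1 hi2
  rw [map_sub, not_le] at hi1
  rw [neg_apply, map_sub, not_le] at hi2
  rw [Real.dist_eq, abs_lt]
  constructor <;> linarith

end WeakContinuity

/-- Every bounded functional on `AC_ω` is the evaluation at a self-adjoint element. -/
theorem exists_eq_apply (F : StrongDual ℝ ω.AC) :
    ∃ a : selfAdjoint A, ‖a‖ ≤ ‖F‖ ∧ ∀ η : ω.AC, F η = (η : StrongDual ℝ (selfAdjoint A)) a := by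
  classical
  obtain ⟨M, hM, hω⟩ := ω.exists_isPredual
  have happ : ∀ i : Finset ω.AC × ℕ, ∃ a : selfAdjoint A, ‖a‖ ≤ ‖F‖ ∧
      ∀ η ∈ i.1, |F η - (η : StrongDual ℝ (selfAdjoint A)) a| < 1 / ((i.2 : ℝ) + 1) := fun i =>
    exists_norm_le_forall_mem_abs_sub_lt F i.1 (by positivity)
  choose x hx hxF using happ
  -- Along `U` the finite sets absorb every functional and the error `1 / (n + 1)` tends to `0`.
  let U : Ultrafilter (Finset ω.AC × ℕ) := Ultrafilter.of atTop
  have hU : (U : Filter (Finset ω.AC × ℕ)) ≤ atTop := Ultrafilter.of_le _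
  have hxU : ∀ᶠ i in (U : Filter (Finset ω.AC × ℕ)), ‖(x i : A)‖ ≤ ‖F‖ := Eventually.of_forall hx
  obtain ⟨a, ha, hlim⟩ := hM.exists_weakLim hxU
  have hsa := hM.isSelfAdjoint_of_weakLim hxU (Eventually.of_forall fun i => (x i).2) hlim
  refine ⟨⟨a, hsa⟩, ha, fun η => ?_⟩
  have h1 := ω.tendsto_of_mem_AC hM hω (a := ⟨a, hsa⟩) η.2 hxU hlim
  have h2 : Tendsto (fun i => (η : StrongDual ℝ (selfAdjoint A)) (x i)) U (𝓝 (F η)) := by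
    rw [Metric.tendsto_nhds]
    intro ε hε
    obtain ⟨n, hn⟩ := exists_nat_one_div_lt hε
    refine hU ((eventually_ge_atTop (({η} : Finset ω.AC), n)).mono fun i hi => ?_)
    rw [Real.dist_eq, abs_sub_comm]
    refine (hxF i η (hi.1 (Finset.mem_singleton_self η))).trans (lt_of_le_of_lt ?_ hn)
    have : (n : ℝ) ≤ i.2 := Nat.cast_le.2 hi.2
    gcongr
  exact tendsto_nhds_unique h2 h1

theorem comp_inclusionAC_injective :
    Function.Injective (fun F : StrongDual ℝ ω.AC => F.comp ω.inclusionAC) := by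
  let _ := CStarAlgebra.spectralOrder A
  have := CStarAlgebra.spectralOrderedRing A
  intro F G hFG
  rw [← sub_eq_zero]
  obtain ⟨a, -, ha⟩ := ω.exists_eq_apply (F - G)
  have h1 : ω.eta a a = 0 := by
    rw [← inclusionAC_etaHilbert, ← ha, sub_apply, sub_eq_zero]
    exact DFunLike.congr_fun hFG (ω.etaHilbert a)
  ext η
  rw [ha]
  exact ω.apply_eq_zero_of_mem_AC η.2 h1

/-- Evaluation of absolutely continuous functionals at a self-adjoint element. -/
noncomputable def evalAC : selfAdjoint A →L[ℝ] StrongDual ℝ ω.AC :=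
  (ω.AC.subtypeL : ω.AC →L[ℝ] StrongDual ℝ (selfAdjoint A)).flip

theorem evalAC_apply (a : selfAdjoint A) (η : ω.AC) :
    ω.evalAC a η = (η : StrongDual ℝ (selfAdjoint A)) a := rfl

/-- Evaluation at `a` pulls back to the Riesz dual of `η_a`, and the `η_a` are dense. -/
theorem denseRange_comp_inclusionAC :
    DenseRange (fun F : StrongDual ℝ ω.AC => F.comp ω.inclusionAC) := by
  have h : DenseRange (InnerProductSpace.toDual ℝ ω.JHilbert ∘ ω.etaHilbert) :=
    (InnerProductSpace.toDual ℝ ω.JHilbert).surjective.denseRange.comp ω.denseRange_etaHilbert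
      (InnerProductSpace.toDual ℝ ω.JHilbert).continuous
  refine h.mono ?_
  rintro _ ⟨a, rfl⟩
  refine ⟨ω.evalAC a, ?_⟩
  ext η
  change inner ℝ η (ω.etaHilbert a) = inner ℝ (ω.etaHilbert a) η
  exact real_inner_comm _ _

/-! ### Representatives in the corner `p A p ⊕ p A q ⊕ q A p` -/

section Corner

variable {ω} {p : A} (hp : ω.IsSupportProjection p)

include hp

theorem eta_self_eq_zero_of_mul_eq_zero {a : selfAdjoint A} (h : p * (a : A) = 0) :
    ω.eta a a = 0 := by
  rw [eta_self_apply, (hp.2.1 _).2.1, ← mul_assoc, h, zero_mul, map_zero, Complex.zero_re]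

/-- Nullity gives `a p = 0` and `p a = 0`, so `a = (1 - p) a (1 - p)`, which is the component that
the corner omits. -/
theorem eq_zero_of_mem_cornerSA {a : selfAdjoint A} (ha : a ∈ cornerSA p)
    (h : ω.eta a a = 0) : a = 0 := by
  let _ := CStarAlgebra.spectralOrder A
  have := CStarAlgebra.spectralOrderedRing A
  have hp2 : p * p = p := hp.1.isIdempotentElem.eq
  have h1 : ω.toDual (star (a : A) * a) = 0 := by
    refine Complex.ext ?_ ?_
    · rw [a.2.star_eq, ← eta_self_apply, h, Complex.zero_re]
    · exact (Complex.le_def.1 (ω.nonneg a)).2.symm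
  have h2 : (a : A) * p = 0 := ω.eq_zero_of_isSupportProjection hp h1
  have h3 : p * (a : A) = 0 := by
    simpa [hp.1.isSelfAdjoint.star_eq, a.2.star_eq] using congr_arg star h2
  obtain ⟨x, y, z, hxyz⟩ := ha
  have h4 : (1 - p) * (a : A) * (1 - p) = 0 := by
    have h5 : p * (1 - p) = 0 := by rw [mul_sub, mul_one, hp2, sub_self]
    have h6 : (1 - p) * p = 0 := by rw [sub_mul, one_mul, hp2, sub_self]
    rw [hxyz, mul_add, mul_add, add_mul, add_mul]
    simp only [← mul_assoc, h6, zero_mul, zero_add]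
    rw [mul_assoc _ p, h5, mul_zero]
  rw [sub_mul, one_mul, h3, sub_zero, mul_sub, mul_one, h2, sub_zero] at h4
  exact Subtype.ext h4

theorem exists_mem_cornerSA (a : selfAdjoint A) :
    ∃ b ∈ cornerSA p, ‖b‖ ≤ 2 * ‖a‖ ∧ ω.eta (a - b) (a - b) = 0 := by
  have hq := hp.1.one_sub
  have hp2 : p * p = p := hp.1.isIdempotentElem.eq
  have hsa : IsSelfAdjoint ((1 - p) * (a : A) * (1 - p)) := by
    have := a.2.conjugate (1 - p)
    rwa [hq.isSelfAdjoint.star_eq] at this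
  let c : selfAdjoint A := ⟨_, hsa⟩
  -- Removing `c = q a q` changes no evaluation on `AC_ω`, since `p c = 0` gives `ω(c²) = 0`. The
  -- bound `‖c‖ ≤ ‖a‖` yields the constant `2`, which makes the inverse of the evaluation map
  -- continuous.
  refine ⟨a - c, ⟨a, a, a, ?_⟩, ?_, ?_⟩
  · change (a : A) - (1 - p) * (a : A) * (1 - p) = _
    noncomm_ring
  · have hc : ‖c‖ ≤ ‖a‖ := by
      change ‖(1 - p) * (a : A) * (1 - p)‖ ≤ ‖(a : A)‖
      refine (norm_mul_le _ _).trans ?_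
      refine (mul_le_of_le_one_right (norm_nonneg _) hq.norm_le).trans ?_
      refine (norm_mul_le _ _).trans ?_
      exact mul_le_of_le_one_left (norm_nonneg _) hq.norm_le
    exact (norm_sub_le _ _).trans (by linarith)
  · rw [sub_sub_cancel]
    refine eta_self_eq_zero_of_mul_eq_zero hp ?_
    change p * ((1 - p) * (a : A) * (1 - p)) = 0
    have h : p * (1 - p) = 0 := by rw [mul_sub, mul_one, hp2, sub_self]
    rw [← mul_assoc, ← mul_assoc, h, zero_mul, zero_mul]

theorem evalAC_cornerSA_injective :
    Function.Injective (ω.evalAC ∘L (cornerSA p).subtypeL) := by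
  rw [injective_iff_map_eq_zero]
  intro a ha
  refine Subtype.ext (eq_zero_of_mem_cornerSA hp a.2 ?_)
  have := DFunLike.congr_fun ha (ω.inclusionAC (ω.etaHilbert a))
  rw [← inclusionAC_etaHilbert]
  exact this

theorem exists_cornerSA_evalAC_eq (F : StrongDual ℝ ω.AC) :
    ∃ b : cornerSA p, ‖b‖ ≤ 2 * ‖F‖ ∧ ω.evalAC b = F := by
  let _ := CStarAlgebra.spectralOrder A
  have := CStarAlgebra.spectralOrderedRing A
  obtain ⟨a, ha, haF⟩ := ω.exists_eq_apply F
  obtain ⟨b, hb, hba, h0⟩ := exists_mem_cornerSA hp a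
  refine ⟨⟨b, hb⟩, hba.trans (by linarith), ?_⟩
  ext η
  have h1 := ω.apply_eq_zero_of_mem_AC η.2 h0
  rw [map_sub, sub_eq_zero] at h1
  rw [haF, evalAC_apply, h1]

theorem evalAC_cornerSA_surjective :
    Function.Surjective (ω.evalAC ∘L (cornerSA p).subtypeL) := fun F => by
  obtain ⟨b, -, hb⟩ := exists_cornerSA_evalAC_eq hp F
  exact ⟨b, hb⟩

/-- Evaluation as a linear equivalence of `(p A p ⊕ p A q ⊕ q A p)_sa` with the dual of `AC_ω`. -/
noncomputable def cornerLinearEquivDualAC : cornerSA p ≃ₗ[ℝ] StrongDual ℝ ω.AC :=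
  LinearEquiv.ofBijective (ω.evalAC ∘L (cornerSA p).subtypeL).toLinearMap
    ⟨evalAC_cornerSA_injective hp, evalAC_cornerSA_surjective hp⟩

theorem norm_cornerLinearEquivDualAC_symm_le (F : StrongDual ℝ ω.AC) :
    ‖(cornerLinearEquivDualAC hp).symm F‖ ≤ 2 * ‖F‖ := by
  obtain ⟨b, hbn, hb⟩ := exists_cornerSA_evalAC_eq hp F
  have hF : (cornerLinearEquivDualAC hp).symm F = b := by
    rw [LinearEquiv.symm_apply_eq]
    exact hb.symm
  rwa [hF]

/-- The dual of `AC_ω` is the self-adjoint part of `p A p ⊕ p A q ⊕ q A p`. -/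
noncomputable def cornerEquivDualAC : cornerSA p ≃L[ℝ] StrongDual ℝ ω.AC where
  toLinearEquiv := cornerLinearEquivDualAC hp
  continuous_toFun := (ω.evalAC ∘L (cornerSA p).subtypeL).continuous
  continuous_invFun := AddMonoidHomClass.continuous_of_bound (cornerLinearEquivDualAC hp).symm 2
    (norm_cornerLinearEquivDualAC_symm_le hp)

theorem cornerEquivDualAC_apply (a : cornerSA p) (η : ω.AC) :
    cornerEquivDualAC hp a η = (η : StrongDual ℝ (selfAdjoint A)) (a : selfAdjoint A) := rfl

end Corner

end NormalPositiveFunctional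

end Duality

theorem mainTheorem4 {A : Type*} [CStarAlgebra A] [WStarAlgebra A]
    (ω : NormalPositiveFunctional A) :
    -- the inclusion of the J-Hilbert space in `AC_ω`
    ∃ i : ω.JHilbert →L[ℝ] ω.AC,
      (∀ ξ : ω.PreJ, ((i (ξ : ω.JHilbert) : ω.AC) : StrongDual ℝ (selfAdjoint A)) =
        (ω.ofPreJ ξ : StrongDual ℝ (selfAdjoint A))) ∧
      (∀ (η : ω.JHilbert) (a : selfAdjoint A),
        (i η : StrongDual ℝ (selfAdjoint A)) a = inner ℝ η (ω.etaPreJ a : ω.JHilbert)) ∧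
      Function.Injective i ∧
      -- the dual map embeds the dual of `AC_ω` densely in the dual of the J-Hilbert space
      Function.Injective (fun F : StrongDual ℝ ω.AC => F.comp i) ∧
      DenseRange (fun F : StrongDual ℝ ω.AC => F.comp i) ∧
      -- the dual of `AC_ω` is the self-adjoint part of `p A p ⊕ p A q ⊕ q A p`
      (∃! p : A, ω.IsSupportProjection p) ∧
      ∀ p : A, ω.IsSupportProjection p →
        ∃ Φ : cornerSA p ≃L[ℝ] StrongDual ℝ ω.AC,
          ∀ (a : cornerSA p) (η : ω.AC),
            Φ a η = (η : StrongDual ℝ (selfAdjoint A)) (a : selfAdjoint A) := by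
  let _ := CStarAlgebra.spectralOrder A
  have := CStarAlgebra.spectralOrderedRing A
  refine ⟨ω.inclusionAC, fun ξ => ?_, ω.inclusionAC_apply, ω.inclusionAC_injective,
    ω.comp_inclusionAC_injective, ω.denseRange_comp_inclusionAC, ?_, fun p hp =>
      ⟨NormalPositiveFunctional.cornerEquivDualAC hp,
        NormalPositiveFunctional.cornerEquivDualAC_apply hp⟩⟩
  · obtain ⟨a, rfl⟩ := ω.etaPreJ_surjective ξ
    exact ω.inclusionAC_etaHilbert a
  · obtain ⟨M, hM, hω⟩ := ω.exists_isPredual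
    obtain ⟨p, hp⟩ := ω.exists_isSupportProjection hM hω
    exact ⟨p, hp, fun p' hp' => ω.isSupportProjection_unique hp' hp⟩
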